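/- For a real number $n>0$ and an integer $t\ge 1$ let \[ Z_{n,t}(\xi)=\frac{2t+n-2}{n-2}\,C_t^{((n-2)/2)}(\xi)\quad(n\ne 2),\qquad Z_{2,t}(\xi)=2T_t(\xi)=\lim_{n\to2}Z_{n,t}(\xi), \] where $C_t^{(\alpha)}(\xi)=\sum_{j=0}^{\lfloor t/2\rfloor}(-1)^j\frac{(\alpha)_{t-j}}{j!\,(t-2j)!}(2\xi)^{t-2j}$, with $(\alpha)_m=\alpha(\alpha+1)\cdots(\alpha+m-1)$, are the Gegenbauer polynomials and $T_t$ is the Chebyshev polynomial of the first kind. For parameters $(v,k,\lambda,\mu)$ put \[ s=\tfrac12\Bigl(\lambda-\mu-\sqrt{(\lambda-\mu)^2+4(k-\mu)}\Bigr),\qquad g=\tfrac12\Bigl(v-1+\frac{2k+(v-1)(\lambda-\mu)}{\sqrt{(\lambda-\mu)^2+4(k-\mu)}}\Bigr),\qquad p=\frac sk,\qquad q=-\frac{s+1}{v-k-1}, \] and, writing $Z=Z_{g,t}$, \[ \Psi_A=v\bigl(Z(1)+kZ(p)+(v-k-1)Z(q)\bigr), \] \[ \Psi_B=vkZ\Bigl(\tfrac{1+p}{\sqrt{2+2p}}\Bigr)+\tfrac{vk\lambda}{2}Z\Bigl(\tfrac{2p}{\sqrt{2+2p}}\Bigr)+v(v-k-1)\mu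 Z\Bigl(\tfrac{p+q}{\sqrt{2+2p}}\Bigr)+\tfrac{v(v-k-1)(k-\mu)}{2}Z\Bigl(\tfrac{2q}{\sqrt{2+2p}}\Bigr), \] \begin{align*} \Psi_{C_0}=\tfrac{vk}{2}\Bigl(&Z(1)+2\lambda Z\bigl(\tfrac{1+3p}{2+2p}\bigr)+2(k-\lambda-1)Z\bigl(\tfrac{1+2p+q}{2+2p}\bigr)+2\lambda(\lambda-1)Z\bigl(\tfrac{3p+q}{2+2p}\bigr)\\ &+\bigl((\mu-1)(k-\lambda-1)-\lambda(\lambda-1)+2\lambda(k-2\lambda)\bigr)Z\bigl(\tfrac{2p+2q}{2+2p}\bigr)\\ &+2\bigl((k-\mu)(k-\lambda-1)-\lambda(k-2\lambda)\bigr)Z\bigl(\tfrac{p+3q}{2+2p}\bigr)\\ &+\bigl(\tfrac{k(v-2k+\lambda)}{2}-(k-\mu)(k-\lambda-1)+\tfrac{\lambda(k-2\lambda)}{2}\bigr)Z\bigl(\tfrac{4q}{2+2p}\bigr)\Bigr), \end{align*} \[ \Psi_{C_1}=6\sum_{l=0}^4(-1)^l\binom4l Z\Bigl(\tfrac{(4-l)p+lq}{2+2p}\Bigr).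 \] \textbf{Theorem.} Let $G$ be a strongly regular graph with parameters $(v,k,\lambda,\mu)$ that is neither complete nor bipartite (so in particular $G$ has an edge, and all the denominators above are nonzero), and let $N$ be the number of $4$-cliques in $G$. Then for every positive integer $t$, \[ \Psi_B^2\le\Psi_A\,\bigl(\Psi_{C_0}+N\,\Psi_{C_1}\bigr). \] -/

import Mathlib

/-! Everything below is a function of the real numbers `v k lam mu`, to be read as the parameters
`(v, k, λ, μ)` of a strongly regular graph. -/

namespace SRG

noncomputable section

/-- The square root of the discriminant, `√((λ - μ)² + 4 (k - μ))`. -/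
def sqrtDisc (k lam mu : ℝ) : ℝ := √((lam - mu) ^ 2 + 4 * (k - mu))

/-- The smallest eigenvalue `s` of the adjacency matrix. -/
def s (k lam mu : ℝ) : ℝ := (1 / 2) * (lam - mu - sqrtDisc k lam mu)

/-- The multiplicity `g` of the eigenvalue `s`, which is the dimension of the Euclidean
representation. -/
def g (v k lam mu : ℝ) : ℝ :=
  (1 / 2) * (v - 1 + (2 * k + (v - 1) * (lam - mu)) / sqrtDisc k lam mu)

/-- The dot product of the unit vectors that represent two adjacent vertices. -/
def p (k lam mu : ℝ) : ℝ := s k lam mu / k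

/-- The dot product of the unit vectors that represent two distinct nonadjacent vertices. -/
def q (v k lam mu : ℝ) : ℝ := -(s k lam mu + 1) / (v - k - 1)

/-- The Gegenbauer polynomial
`C_t^{(α)}(ξ) = ∑_{j ≤ t/2} (-1)^j (α)_{t-j} / (j! (t-2j)!) (2ξ)^{t-2j}`,
where `(α)_m = α (α + 1) ⋯ (α + m - 1)`. -/
def gegenbauer (α : ℝ) (t : ℕ) (ξ : ℝ) : ℝ :=
  ∑ j ∈ Finset.range (t / 2 + 1),
    (-1) ^ j * (ascPochhammer ℝ (t - j)).eval α / ((j.factorial : ℝ) * ((t - 2 * j).factorial : ℝ))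
      * (2 * ξ) ^ (t - 2 * j)

/-- The zonal harmonic `Z_{n,t}(ξ) = (2t + n - 2) / (n - 2) * C_t^{((n-2)/2)}(ξ)` of degree
`t ≥ 1`. For `n = 2` this expression has a removable singularity, and its limit as `n → 2` is
`2 T_t(ξ)`, where `T_t` is the Chebyshev polynomial of the first kind. In all cases
`Z_{n,t}(ξ)` is the coefficient of `z^t` in `(1 - z²) (1 - 2ξz + z²)^{-n/2}`. -/
def Z (n : ℝ) (t : ℕ) (ξ : ℝ) : ℝ :=
  if n = 2 then 2 * (Polynomial.Chebyshev.T ℝ (t : ℤ)).eval ξ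
  else (2 * (t : ℝ) + n - 2) / (n - 2) * gegenbauer ((n - 2) / 2) t ξ

/-- `Ψ_A(v, k, λ, μ, t)`. -/
def PsiA (v k lam mu : ℝ) (t : ℕ) : ℝ :=
  let Zg := Z (g v k lam mu) t
  let p := p k lam mu
  let q := q v k lam mu
  v * (Zg 1 + k * Zg p + (v - k - 1) * Zg q)

/-- `Ψ_B(v, k, λ, μ, t)`. -/
def PsiB (v k lam mu : ℝ) (t : ℕ) : ℝ :=
  let Zg := Z (g v k lam mu) t
  let p := p k lam mu
  let q := q v k lam mu
  v * k * Zg ((1 + p) / √(2 + 2 * p))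
    + v * k * lam / 2 * Zg (2 * p / √(2 + 2 * p))
    + v * (v - k - 1) * mu * Zg ((p + q) / √(2 + 2 * p))
    + v * (v - k - 1) * (k - mu) / 2 * Zg (2 * q / √(2 + 2 * p))

/-- `Ψ_{C_0}(v, k, λ, μ, t)`. -/
def PsiC0 (v k lam mu : ℝ) (t : ℕ) : ℝ :=
  let Zg := Z (g v k lam mu) t
  let p := p k lam mu
  let q := q v k lam mu
  v * k / 2 *
    (Zg 1
      + 2 * lam * Zg ((1 + 3 * p) / (2 + 2 * p))
      + 2 * (k - lam - 1) * Zg ((1 + 2 * p + q) / (2 + 2 * p))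
      + 2 * lam * (lam - 1) * Zg ((3 * p + q) / (2 + 2 * p))
      + ((mu - 1) * (k - lam - 1) - lam * (lam - 1) + 2 * lam * (k - 2 * lam))
          * Zg ((2 * p + 2 * q) / (2 + 2 * p))
      + 2 * ((k - mu) * (k - lam - 1) - lam * (k - 2 * lam)) * Zg ((p + 3 * q) / (2 + 2 * p))
      + (k * (v - 2 * k + lam) / 2 - (k - mu) * (k - lam - 1) + lam * (k - 2 * lam) / 2)
          * Zg (4 * q / (2 + 2 * p)))

/-- `Ψ_{C_1}(v, k, λ, μ, t)`. -/
def PsiC1 (v k lam mu : ℝ) (t : ℕ) : ℝ :=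
  let Zg := Z (g v k lam mu) t
  let p := p k lam mu
  let q := q v k lam mu
  6 * ∑ l ∈ Finset.range 5,
    (-1) ^ l * (Nat.choose 4 l : ℝ) * Zg (((4 - (l : ℝ)) * p + (l : ℝ) * q) / (2 + 2 * p))

end

end SRG

/-!
The `s`-eigenspace of the adjacency matrix `A` represents the vertices of `G` by unit vectors
`x u` in `ℝᵍ`: the matrix `M = I + p A + q (J - I - A)` satisfies `M² = c M` with `c = v / g`, so
`c⁻¹ M` is an orthogonal projection of trace `g`, and its columns, written in an orthonormal basis
of the range and rescaled, have Gram matrix `M` (`SRGRepresentation.exists_representation`). Since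
`G` is not bipartite, adjacent vertices are not represented by opposite vectors, so `-1 < p`
(`SRGRepresentation.neg_one_lt_p`), and every edge `ab` has the unit vector
`(x a + x b) / √(2 + 2p)`.

The kernel `(x, y) ↦ Z_{g,t}(⟨x, y⟩)` is positive semidefinite on the unit sphere
(`ZonalHarmonic.sum_mul_Z_nonneg`). For `g ≠ 2` this is the reproducing property of the zonal
harmonics for the Fischer pairing `[P, Q] = P(∂) Q` on forms of degree `t`; for `g = 2` it is the
addition formula of the cosine. Giving weight `z` to each vertex and weight `1` to each ordered
edge, the kernel yields a quadratic polynomial in `z` without negative values. Its coefficients are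
`Ψ_A`, `4 Ψ_B` and `4 (Ψ_{C₀} + N Ψ_{C₁})`, and the inequality says that its discriminant is not
positive.

The coefficients are found by counting how vertices and edges lie relative to a fixed edge `ab`.
For an edge `cd` disjoint from `ab`, a function of the number of adjacencies between the two
edges is a combination of the elementary symmetric functions of the four adjacency indicators. The
parameters determine the sums of those of degree at most three, while the one of degree four counts
`4`-cliques (`SRGCounting.disjointSum_adjacency_count`, `SRGCounting.sum_four_clique`).
-/

namespace ZonalHarmonic

open MvPolynomial

/-! ### The Fischer pairing -/

section Fischer

variable {σ : Type*}

/-- The weight `m! = ∏ i, (m i)!` of a monomial. -/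
noncomputable def monomialFactorial (m : σ →₀ ℕ) : ℝ := m.prod fun _ a => (a.factorial : ℝ)

/-- The Fischer pairing `[P, Q] = P(∂) Q` evaluated at `0`: distinct monomials are orthogonal, and
`[X ^ m, X ^ m] = m!`. -/
noncomputable def fischer : MvPolynomial σ ℝ →ₗ[ℝ] MvPolynomial σ ℝ →ₗ[ℝ] ℝ :=
  (basisMonomials σ ℝ).constr ℝ fun m => monomialFactorial m • lcoeff ℝ m

lemma fischer_monomial (m : σ →₀ ℕ) (a : ℝ) (Q : MvPolynomial σ ℝ) :
    fischer (monomial m a) Q = a * (monomialFactorial m * coeff m Q) := by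
  have h : fischer (monomial m (1 : ℝ)) = monomialFactorial m • lcoeff ℝ m := by
    exact (basisMonomials σ ℝ).constr_basis ℝ _ m
  rw [← mul_one a, ← smul_eq_mul, ← smul_monomial, map_smul, h]
  simp [lcoeff]

lemma monomialFactorial_pos (m : σ →₀ ℕ) : 0 < monomialFactorial m :=
  Finset.prod_pos fun i _ => by positivity

lemma monomialFactorial_add_single (m : σ →₀ ℕ) (i : σ) :
    monomialFactorial (m + Finsupp.single i 1) = (m i + 1) * monomialFactorial m := by
  classical
  unfold monomialFactorial
  rw [Finsupp.prod_of_support_subset (s := insert i m.support),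
    Finsupp.prod_of_support_subset (s := insert i m.support) m,
    ← Finset.mul_prod_erase _ _ (Finset.mem_insert_self i _),
    ← Finset.mul_prod_erase (insert i m.support) _ (Finset.mem_insert_self i _), ← mul_assoc]
  · congr 1
    · simp [Nat.factorial_succ]
    · refine Finset.prod_congr rfl fun j hj => ?_
      simp [(Finset.ne_of_mem_erase hj).symm]
  · exact Finset.subset_insert _ _
  · simp
  · intro j hj
    have := Finsupp.support_add hj
    simp only [Finset.mem_union, Finsupp.mem_support_iff, Finsupp.single_apply] at this
    simp only [Finset.mem_insert, Finsupp.mem_support_iff]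
    grind
  · simp

lemma fischer_apply (P Q : MvPolynomial σ ℝ) :
    fischer P Q = ∑ m ∈ P.support, coeff m P * (monomialFactorial m * coeff m Q) := by
  conv_lhs => rw [P.as_sum]
  simp only [map_sum, LinearMap.sum_apply, fischer_monomial]

lemma fischer_self_nonneg (P : MvPolynomial σ ℝ) : 0 ≤ fischer P P := by
  rw [fischer_apply]
  refine Finset.sum_nonneg fun m _ => ?_
  nlinarith [mul_nonneg (monomialFactorial_pos m).le (mul_self_nonneg (coeff m P))]

/-- Multiplication by `X i` is adjoint to differentiation for the Fischer pairing. -/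
lemma fischer_X_mul (i : σ) (P Q : MvPolynomial σ ℝ) :
    fischer (X i * P) Q = fischer P (pderiv i Q) := by
  induction P using MvPolynomial.induction_on' with
  | monomial m a =>
    rw [X, monomial_mul, fischer_monomial, fischer_monomial, coeff_pderiv, add_comm,
      monomialFactorial_add_single]
    ring
  | add p q hp hq => simp [mul_add, hp, hq]

lemma fischer_C_mul (a : ℝ) (P Q : MvPolynomial σ ℝ) :
    fischer (C a * P) Q = a * fischer P Q := by
  rw [C_mul', map_smul, LinearMap.smul_apply, smul_eq_mul]

end Fischer

/-! ### Zonal harmonics -/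

variable {n : ℕ}

/-- The linear form `x ↦ ⟨y, x⟩` as a polynomial. -/
noncomputable def linForm (y : Fin n → ℝ) : MvPolynomial (Fin n) ℝ := ∑ i, C (y i) * X i

/-- The squared Euclidean norm `x ↦ |x|²` as a polynomial. -/
noncomputable def normSq (n : ℕ) : MvPolynomial (Fin n) ℝ := ∑ i, X i ^ 2

/-- The Laplacian on polynomials. -/
noncomputable def laplacian : MvPolynomial (Fin n) ℝ →ₗ[ℝ] MvPolynomial (Fin n) ℝ :=
  ∑ i, (pderiv i).toLinearMap ∘ₗ (pderiv i).toLinearMap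

lemma laplacian_apply (P : MvPolynomial (Fin n) ℝ) :
    laplacian P = ∑ i, pderiv i (pderiv i P) := by
  simp [laplacian]

lemma fischer_normSq_mul (P Q : MvPolynomial (Fin n) ℝ) :
    fischer (normSq n * P) Q = fischer P (laplacian Q) := by
  simp only [normSq, Finset.sum_mul, map_sum, LinearMap.sum_apply, laplacian_apply, pow_two,
    mul_assoc, fischer_X_mul]

/-- Pairing with the `t`-th power of `⟨x, ·⟩` evaluates a form of degree `t` at `x`. -/
lemma fischer_linForm_pow (x : Fin n → ℝ) (t : ℕ) :
    ∀ Q : MvPolynomial (Fin n) ℝ, Q.IsHomogeneous t →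
      fischer (linForm x ^ t) Q = t.factorial * eval x Q := by
  induction t with
  | zero =>
    intro Q hQ
    obtain ⟨c, rfl⟩ : ∃ c, Q = C c :=
      ⟨_, (totalDegree_eq_zero_iff_eq_C).1 ((totalDegree_zero_iff_isHomogeneous _).2 hQ)⟩
    rw [pow_zero, ← C_1, C_apply, fischer_monomial]
    simp [monomialFactorial]
  | succ t ih =>
    intro Q hQ
    have hE := congrArg (eval x) hQ.sum_X_mul_pderiv
    simp only [map_sum, map_mul, eval_X, nsmul_eq_mul, map_natCast] at hE
    have hd : ∀ i, (pderiv i Q).IsHomogeneous t := fun i => hQ.pderiv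
    rw [pow_succ', linForm, Finset.sum_mul, map_sum, LinearMap.sum_apply]
    simp only [mul_assoc, fischer_C_mul, fischer_X_mul]
    have : ∀ i, fischer ((∑ j, C (x j) * X j) ^ t) (pderiv i Q)
        = t.factorial * eval x (pderiv i Q) := fun i => ih _ (hd i)
    simp only [this]
    rw [Nat.factorial_succ, Nat.cast_mul, mul_comm ((t + 1 : ℕ) : ℝ), mul_assoc, ← hE,
      Finset.mul_sum]
    exact Finset.sum_congr rfl fun i _ => by ring

lemma pderiv_linForm (y : Fin n → ℝ) (i : Fin n) : pderiv i (linForm y) = C (y i) := by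
  simp [linForm, pderiv_X, Pi.single_apply]

lemma pderiv_normSq (i : Fin n) : pderiv i (normSq n) = 2 * X i := by
  simp [normSq, pderiv_X, Pi.single_apply]

/-- The Laplacian of `⟨y, x⟩ ^ a * |x| ^ (2 b)` for a unit vector `y`. -/
lemma laplacian_linForm_pow_mul_normSq_pow (y : Fin n → ℝ) (hy : y ⬝ᵥ y = 1) (a b : ℕ) :
    laplacian (linForm y ^ a * normSq n ^ b)
      = C ((a : ℝ) * (a - 1)) * (linForm y ^ (a - 2) * normSq n ^ b)
        + C ((2 : ℝ) * b * (2 * a + 2 * b + n - 2)) * (linForm y ^ a * normSq n ^ (b - 1)) := by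
  have hd : ∀ (i : Fin n) (a b : ℕ), pderiv i (linForm y ^ a * normSq n ^ b)
      = (a : MvPolynomial (Fin n) ℝ) * C (y i) * (linForm y ^ (a - 1) * normSq n ^ b)
        + 2 * (b : MvPolynomial (Fin n) ℝ) * X i * (linForm y ^ a * normSq n ^ (b - 1)) := by
    intro i a b
    rw [pderiv_mul, pderiv_pow, pderiv_pow, pderiv_linForm, pderiv_normSq]
    ring
  have hpow : ∀ (P : MvPolynomial (Fin n) ℝ) (m : ℕ),
      (m : MvPolynomial (Fin n) ℝ) * (P * P ^ (m - 1)) = m * P ^ m := by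
    rintro P (_ | m)
    · simp
    · rw [Nat.add_sub_cancel, pow_succ']
  have hcast : ∀ m : ℕ, (m : MvPolynomial (Fin n) ℝ) * ((m - 1 : ℕ) : MvPolynomial (Fin n) ℝ)
      = m * (m - 1) := by
    rintro (_ | m) <;> simp
  have hyC : ∑ i, C (y i) * C (y i) = (1 : MvPolynomial (Fin n) ℝ) := by
    rw [← C_1, ← hy, dotProduct, map_sum]
    simp
  have hL : ∑ i, C (y i) * X i = linForm y := rfl
  have hN : ∑ i, X i * X i = normSq n := by simp [normSq, pow_two]
  set L := linForm y
  set N := normSq n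
  have hca := hcast a
  have hcb := hcast b
  have e1 : ∀ i, pderiv i (a : MvPolynomial (Fin n) ℝ) = 0 := by simp
  have e2 : ∀ i, pderiv i (b : MvPolynomial (Fin n) ℝ) = 0 := by simp
  have hda := fun i => hd i a b
  have hda' := fun i => hd i (a - 1) b
  have hdb' := fun i => hd i a (b - 1)
  have h1 := hpow L a
  have h2 : (b : MvPolynomial (Fin n) ℝ) * (b - 1) * (N * N ^ (b - 2))
      = b * (b - 1) * N ^ (b - 1) := by
    have := hpow N (b - 1)
    rw [Nat.sub_sub] at this
    rw [← hcast, mul_assoc, this, mul_assoc]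
  simp only [map_mul, map_add, map_sub, map_natCast, map_ofNat, map_one]
  generalize (a : MvPolynomial (Fin n) ℝ) = a' at *
  generalize (b : MvPolynomial (Fin n) ℝ) = b' at *
  have hi : ∀ i, pderiv i (pderiv i (L ^ a * N ^ b))
      = (C (y i) * C (y i)) * (a' * (a' - 1) * (L ^ (a - 2) * N ^ b))
        + (C (y i) * X i) * (4 * a' * b' * (L ^ (a - 1) * N ^ (b - 1)))
        + (X i * X i) * (4 * (b' * (b' - 1)) * (L ^ a * N ^ (b - 2)))
        + 2 * b' * (L ^ a * N ^ (b - 1)) := by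
    intro i
    have e3 : pderiv i (2 : MvPolynomial (Fin n) ℝ) = 0 := by
      simpa using (pderiv i).map_natCast 2
    rw [hda, map_add, pderiv_mul, pderiv_mul (f := 2 * _ * _), hda', hdb', pderiv_mul, pderiv_mul,
      pderiv_mul, e1, e2, e3, pderiv_C, pderiv_X_self, Nat.sub_sub, Nat.sub_sub]
    linear_combination (C (y i) * C (y i) * (L ^ (a - 2) * N ^ b)) * hca
      + (4 * (X i * X i) * (L ^ a * N ^ (b - 2))) * hcb
  rw [laplacian_apply, Finset.sum_congr rfl fun i _ => hi i, Finset.sum_add_distrib,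
    Finset.sum_add_distrib, Finset.sum_add_distrib, ← Finset.sum_mul, ← Finset.sum_mul,
    ← Finset.sum_mul, hyC, hL, hN, Finset.sum_const, Finset.card_univ, Fintype.card_fin,
    nsmul_eq_mul]
  linear_combination (4 * b' * N ^ (b - 1)) * h1 + (4 * L ^ a) * h2

/-- The coefficients of `Z_{n,t}(ξ)`, for `t ≥ 1`, with the factor `n - 2` of the denominator
cancelled against the first factor of the Pochhammer symbol. -/
noncomputable def zonalCoeff (n : ℝ) (t j : ℕ) : ℝ :=
  (2 * t + n - 2) / 2 * ((-1) ^ j * (ascPochhammer ℝ (t - j - 1)).eval (n / 2)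
    / ((j.factorial : ℝ) * ((t - 2 * j).factorial : ℝ)) * 2 ^ (t - 2 * j))

/-- The zonal harmonic with pole `y` as a form of degree `t`: for a unit vector `y`, its value at
a unit vector `x` is `Z_{n,t}(⟨x, y⟩)`. -/
noncomputable def zonal (t : ℕ) (y : Fin n → ℝ) : MvPolynomial (Fin n) ℝ :=
  ∑ j ∈ Finset.range (t / 2 + 1),
    C (zonalCoeff n t j) * (linForm y ^ (t - 2 * j) * normSq n ^ j)

/-- This holds for `n = 1` as well, because the factor `n - 2` has been cancelled. -/
lemma zonalCoeff_zero_pos (hn : 0 < n) {t : ℕ} (ht : 0 < t) : 0 < zonalCoeff n t 0 := by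
  have hn' : (1 : ℝ) ≤ n := by exact_mod_cast hn
  have ht' : (1 : ℝ) ≤ t := by exact_mod_cast ht
  have h := ascPochhammer_pos (t - 0 - 1) ((n : ℝ) / 2) (by positivity)
  have h2 : 0 < 2 * (t : ℝ) + n - 2 := by linarith
  unfold zonalCoeff
  positivity

/-- The recurrence of the coefficients that makes the zonal polynomials harmonic. -/
lemma zonalCoeff_succ (n : ℝ) (t j : ℕ) (hj : 2 * (j + 1) ≤ t) :
    zonalCoeff n t j * (((t - 2 * j : ℕ) : ℝ) * (((t - 2 * j : ℕ) : ℝ) - 1))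
      + zonalCoeff n t (j + 1) * (2 * ((j + 1 : ℕ) : ℝ) *
          (2 * ((t - 2 * (j + 1) : ℕ) : ℝ) + 2 * ((j + 1 : ℕ) : ℝ) + n - 2)) = 0 := by
  obtain ⟨m, rfl⟩ := Nat.exists_eq_add_of_le hj
  have e1 : 2 * (j + 1) + m - 2 * j = m + 2 := by omega
  have e2 : 2 * (j + 1) + m - 2 * (j + 1) = m := by omega
  have e3 : 2 * (j + 1) + m - j - 1 = (j + m) + 1 := by omega
  have e4 : 2 * (j + 1) + m - (j + 1) - 1 = j + m := by omega
  unfold zonalCoeff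
  rw [e1, e2, e3, e4, ascPochhammer_succ_eval, Nat.factorial_succ, Nat.factorial_succ,
    Nat.factorial_succ]
  have := Nat.factorial_ne_zero j
  have := Nat.factorial_ne_zero m
  push_cast
  field_simp
  ring

lemma laplacian_zonal (t : ℕ) (y : Fin n → ℝ) (hy : y ⬝ᵥ y = 1) :
    laplacian (zonal t y) = 0 := by
  set f : ℕ → MvPolynomial (Fin n) ℝ := fun j =>
    C (zonalCoeff n t j * (((t - 2 * j : ℕ) : ℝ) * (((t - 2 * j : ℕ) : ℝ) - 1))) *
      (linForm y ^ (t - 2 * j - 2) * normSq n ^ j) with hf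
  set h : ℕ → MvPolynomial (Fin n) ℝ := fun j =>
    C (zonalCoeff n t j * (2 * (j : ℝ) * (2 * ((t - 2 * j : ℕ) : ℝ) + 2 * (j : ℝ) + n - 2))) *
      (linForm y ^ (t - 2 * j) * normSq n ^ (j - 1)) with hh
  have key : laplacian (zonal t y) = ∑ j ∈ Finset.range (t / 2 + 1), (f j + h j) := by
    rw [zonal, map_sum]
    refine Finset.sum_congr rfl fun j _ => ?_
    rw [C_mul', map_smul, laplacian_linForm_pow_mul_normSq_pow y hy, ← C_mul', hf, hh]
    simp only [C_mul]
    ring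
  -- The sum telescopes: `f j` cancels `h (j + 1)`, while `h 0` and the last `f` vanish.
  rw [key, Finset.sum_add_distrib, Finset.sum_range_succ, Finset.sum_range_succ' h]
  have h0 : h 0 = 0 := by simp [hh]
  have hlast : f (t / 2) = 0 := by
    obtain e | e : t - 2 * (t / 2) = 0 ∨ t - 2 * (t / 2) = 1 := by omega
    · simp [hf, e]
    · simp [hf, e]
  rw [h0, hlast, add_zero, add_zero, ← Finset.sum_add_distrib]
  refine Finset.sum_eq_zero fun j hj => ?_
  have hj' : 2 * (j + 1) ≤ t := by
    have := Finset.mem_range.1 hj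
    omega
  have e : t - 2 * j - 2 = t - 2 * (j + 1) := by omega
  simp only [hf, hh]
  rw [e, Nat.add_sub_cancel, ← add_mul, ← C_add, zonalCoeff_succ n t j hj', C_0, zero_mul]

lemma isHomogeneous_zonal (t : ℕ) (y : Fin n → ℝ) : (zonal t y).IsHomogeneous t := by
  refine IsHomogeneous.sum _ _ _ fun j hj => ?_
  have hj' : 2 * j ≤ t := by
    have := Finset.mem_range.1 hj
    omega
  have hL : (linForm y).IsHomogeneous 1 :=
    IsHomogeneous.sum _ _ _ fun i _ => by
      simpa using (isHomogeneous_C (Fin n) (y i)).mul (isHomogeneous_X ℝ i)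
  have hN : (normSq n).IsHomogeneous 2 :=
    IsHomogeneous.sum _ _ _ fun i _ => by
      simpa using (isHomogeneous_X ℝ i).pow 2
  have := (isHomogeneous_C (Fin n) (zonalCoeff n t j)).mul
    ((hL.pow (t - 2 * j)).mul (hN.pow j))
  convert this using 1
  omega

lemma eval_zonal {t : ℕ} (ht : 0 < t) (hn : (n : ℝ) ≠ 2) (x y : Fin n → ℝ) (hx : x ⬝ᵥ x = 1) :
    eval x (zonal t y) = SRG.Z n t (x ⬝ᵥ y) := by
  have hn' : (n : ℝ) - 2 ≠ 0 := sub_ne_zero.2 hn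
  rw [SRG.Z, if_neg hn, SRG.gegenbauer, zonal, map_sum, Finset.mul_sum]
  refine Finset.sum_congr rfl fun j hj => ?_
  have hL : eval x (linForm y) = x ⬝ᵥ y := by
    simp [linForm, dotProduct, mul_comm]
  have hN : eval x (normSq n) = 1 := by
    simp [normSq, ← hx, dotProduct, pow_two]
  have hj' : t - j = (t - j - 1) + 1 := by
    have := Finset.mem_range.1 hj
    omega
  have hP : (ascPochhammer ℝ (t - j)).eval (((n : ℝ) - 2) / 2)
      = ((n : ℝ) - 2) / 2 * (ascPochhammer ℝ (t - j - 1)).eval ((n : ℝ) / 2) := by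
    conv_lhs => rw [hj', ascPochhammer_succ_left]
    simp only [Polynomial.eval_mul, Polynomial.eval_X, Polynomial.eval_comp, Polynomial.eval_add,
      Polynomial.eval_one]
    congr 3
    ring
  simp only [map_mul, map_pow, eval_C, hL, hN, one_pow, mul_one, hP, zonalCoeff, mul_pow]
  field_simp

/-- The reproducing property of the zonal harmonics. Modulo multiples of `|x|²`, to which harmonic
polynomials are orthogonal, `zonal t x` is a multiple of `⟨x, ·⟩ ^ t`. -/
lemma fischer_zonal (t : ℕ) (x y : Fin n → ℝ) (hy : y ⬝ᵥ y = 1) :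
    fischer (zonal t x) (zonal t y)
      = zonalCoeff n t 0 * t.factorial * eval x (zonal t y) := by
  have h : ∀ j ∈ Finset.range (t / 2),
      fischer (C (zonalCoeff n t (j + 1)) * (linForm x ^ (t - 2 * (j + 1)) * normSq n ^ (j + 1)))
        (zonal t y) = 0 := by
    intro j _
    rw [fischer_C_mul, pow_succ', mul_left_comm, fischer_normSq_mul, laplacian_zonal t y hy,
      map_zero, mul_zero]
  conv_lhs => rw [zonal]
  rw [map_sum, LinearMap.sum_apply, Finset.sum_range_succ', Finset.sum_eq_zero h, zero_add,
    fischer_C_mul, mul_zero, Nat.sub_zero, pow_zero, mul_one,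
    fischer_linForm_pow x t _ (isHomogeneous_zonal t y), mul_assoc]

/-! ### Positive semidefiniteness on the sphere -/

/-- The circle case: `T_t (cos (α - β)) = cos (t α) cos (t β) + sin (t α) sin (t β)`. -/
lemma exists_feature_chebyshev (t : ℕ) : ∃ c s : (Fin 2 → ℝ) → ℝ, ∀ x y : Fin 2 → ℝ,
    x ⬝ᵥ x = 1 → y ⬝ᵥ y = 1 →
      (Polynomial.Chebyshev.T ℝ (t : ℤ)).eval (x ⬝ᵥ y) = c x * c y + s x * s y := by
  set θ : (Fin 2 → ℝ) → ℝ := fun x => Complex.arg ⟨x 0, x 1⟩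
  have hθ : ∀ x : Fin 2 → ℝ, x ⬝ᵥ x = 1 → Real.cos (θ x) = x 0 ∧ Real.sin (θ x) = x 1 := by
    intro x hx
    have hnorm : ‖(⟨x 0, x 1⟩ : ℂ)‖ = 1 := by
      rw [Complex.norm_def, Real.sqrt_eq_one, Complex.normSq_mk, ← hx]
      simp [dotProduct, Fin.sum_univ_two]
    have h0 : (⟨x 0, x 1⟩ : ℂ) ≠ 0 := by
      rw [← norm_ne_zero_iff, hnorm]
      exact one_ne_zero
    exact ⟨by simp [θ, Complex.cos_arg h0, hnorm], by simp [θ, Complex.sin_arg, hnorm]⟩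
  refine ⟨fun x => Real.cos (t * θ x), fun x => Real.sin (t * θ x), fun x y hx hy => ?_⟩
  have : x ⬝ᵥ y = Real.cos (θ x - θ y) := by
    rw [Real.cos_sub, (hθ x hx).1, (hθ x hx).2, (hθ y hy).1, (hθ y hy).2]
    simp [dotProduct, Fin.sum_univ_two]
  rw [this, Polynomial.Chebyshev.T_real_cos, ← Real.cos_sub]
  push_cast
  ring_nf

/-- `Z_{n,t}` is a positive semidefinite kernel on the unit sphere of `ℝⁿ`. Points of weight `0`
are allowed to lie off the sphere. -/
theorem sum_mul_Z_nonneg (hn : 0 < n) {t : ℕ} (ht : 0 < t) {ι : Type*} [Fintype ι]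
    (w : ι → ℝ) (x : ι → Fin n → ℝ) (hx : ∀ i, w i ≠ 0 → x i ⬝ᵥ x i = 1) :
    0 ≤ ∑ i, ∑ j, w i * w j * SRG.Z n t (x i ⬝ᵥ x j) := by
  by_cases h2 : n = 2
  · subst h2
    obtain ⟨c, s, hcs⟩ := exists_feature_chebyshev t
    have h : ∀ i j, w i * w j * SRG.Z (2 : ℕ) t (x i ⬝ᵥ x j)
        = 2 * ((w i * c (x i)) * (w j * c (x j)) + (w i * s (x i)) * (w j * s (x j))) := by
      intro i j
      by_cases hi : w i = 0
      · simp [hi]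
      by_cases hj : w j = 0
      · simp [hj]
      rw [SRG.Z, if_pos (by norm_num), hcs _ _ (hx i hi) (hx j hj)]
      ring
    simp only [h, ← Finset.mul_sum, Finset.sum_add_distrib, ← Finset.sum_mul]
    nlinarith [mul_self_nonneg (∑ i, w i * c (x i)), mul_self_nonneg (∑ i, w i * s (x i))]
  · have hκ : 0 < zonalCoeff n t 0 * t.factorial :=
      mul_pos (zonalCoeff_zero_pos hn ht) (by positivity)
    have h : ∀ i j, (zonalCoeff n t 0 * t.factorial) * (w i * w j * SRG.Z n t (x i ⬝ᵥ x j))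
        = fischer (C (w i) * zonal t (x i)) (C (w j) * zonal t (x j)) := by
      intro i j
      by_cases hi : w i = 0
      · simp [hi]
      by_cases hj : w j = 0
      · simp [hj]
      rw [C_mul', C_mul', map_smul, map_smul, LinearMap.smul_apply,
        fischer_zonal t _ _ (hx j hj), eval_zonal ht (by exact_mod_cast h2) _ _ (hx i hi)]
      simp only [smul_eq_mul]
      ring
    have hs : (zonalCoeff n t 0 * t.factorial) * ∑ i, ∑ j, w i * w j * SRG.Z n t (x i ⬝ᵥ x j)
        = fischer (∑ i, C (w i) * zonal t (x i)) (∑ i, C (w i) * zonal t (x i)) := by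
      simp only [Finset.mul_sum, h, map_sum, LinearMap.sum_apply]
      exact Finset.sum_comm
    exact nonneg_of_mul_nonneg_right (hs ▸ fischer_self_nonneg _) hκ

end ZonalHarmonic

namespace SRGRepresentation

open Matrix

/-! ### Identities between the parameters -/

section Parameters

variable {v k lam mu : ℝ}

lemma sqrtDisc_pos (hmu : mu ≤ k) (hlam : lam < k) : 0 < SRG.sqrtDisc k lam mu := by
  refine Real.sqrt_pos.2 ?_
  rcases hmu.lt_or_eq with h | rfl
  · nlinarith [sq_nonneg (lam - mu)]
  · nlinarith [mul_pos (sub_pos.2 hlam) (sub_pos.2 hlam)]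

lemma s_sq (hmu : mu ≤ k) : SRG.s k lam mu ^ 2 = (lam - mu) * SRG.s k lam mu + (k - mu) := by
  have h : SRG.sqrtDisc k lam mu ^ 2 = (lam - mu) ^ 2 + 4 * (k - mu) :=
    Real.sq_sqrt (by nlinarith [sq_nonneg (lam - mu)])
  unfold SRG.s
  linear_combination h / 4

/-- The constant `c` for which the Gram matrix `M` of the representation satisfies `M² = c M`. -/
noncomputable def gramScale (v k lam mu : ℝ) : ℝ :=
  1 - SRG.q v k lam mu + (SRG.p k lam mu - SRG.q v k lam mu) * SRG.s k lam mu

lemma mul_p (hk : 0 < k) : k * SRG.p k lam mu = SRG.s k lam mu := by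
  unfold SRG.p
  field_simp

lemma mul_q (hv : 0 < v - k - 1) :
    (v - k - 1) * SRG.q v k lam mu = -(SRG.s k lam mu + 1) := by
  unfold SRG.q
  field_simp

lemma gramScale_eq (hk : 0 < k) (hv : 0 < v - k - 1) :
    gramScale v k lam mu
      = 1 + SRG.s k lam mu ^ 2 / k + (SRG.s k lam mu + 1) ^ 2 / (v - k - 1) := by
  unfold gramScale SRG.p SRG.q
  field_simp
  ring

lemma gramScale_pos (hk : 0 < k) (hv : 0 < v - k - 1) : 0 < gramScale v k lam mu := by
  rw [gramScale_eq hk hv]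
  positivity

/-- The relation between `p` and `q` that makes the Gram matrix an eigenmatrix of the adjacency
matrix, for the eigenvalue `s`. -/
lemma one_sub_q_eq (hk : 0 < k) (hv : 0 < v - k - 1) (hmu : mu ≤ k)
    (hpar : k * (k - lam - 1) = (v - k - 1) * mu) :
    1 - SRG.q v k lam mu =
      (SRG.p k lam mu - SRG.q v k lam mu) * (SRG.s k lam mu - (lam - mu)) := by
  have hs := s_sq (lam := lam) hmu
  unfold SRG.p SRG.q
  generalize SRG.s k lam mu = s at *
  obtain ⟨w, rfl⟩ : ∃ w, v = w + k + 1 := ⟨v - k - 1, by ring⟩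
  have e : w + k + 1 - k - 1 = w := by ring
  rw [e] at hv hpar ⊢
  field_simp
  linear_combination (-(w + k)) * hs - hpar

/-- The companion of `one_sub_q_eq` for the coefficient of the all-ones matrix. -/
lemma q_mul_eq (hk : 0 < k) (hv : 0 < v - k - 1) (hmu : mu ≤ k)
    (hpar : k * (k - lam - 1) = (v - k - 1) * mu) :
    (SRG.p k lam mu - SRG.q v k lam mu) * mu + SRG.q v k lam mu * k
      = SRG.s k lam mu * SRG.q v k lam mu := by
  have hs := s_sq (lam := lam) hmu
  unfold SRG.p SRG.q
  generalize SRG.s k lam mu = s at *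
  obtain ⟨w, rfl⟩ : ∃ w, v = w + k + 1 := ⟨v - k - 1, by ring⟩
  have e : w + k + 1 - k - 1 = w := by ring
  rw [e] at hv hpar ⊢
  field_simp
  linear_combination k * hs - s * hpar

/-- The trace of the projection `c⁻¹ M` is `v / c = g`. -/
lemma g_mul_gramScale (hk : 0 < k) (hv : 0 < v - k - 1) (hmu : mu ≤ k) (hlam : lam < k)
    (hpar : k * (k - lam - 1) = (v - k - 1) * mu) :
    SRG.g v k lam mu * gramScale v k lam mu = v := by
  have hs := s_sq (lam := lam) hmu
  have hr := sqrtDisc_pos hmu hlam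
  rw [gramScale_eq hk hv]
  unfold SRG.g
  have hrs : SRG.sqrtDisc k lam mu = lam - mu - 2 * SRG.s k lam mu := by
    unfold SRG.s
    ring
  rw [hrs] at hr ⊢
  generalize SRG.s k lam mu = s at *
  obtain ⟨w, rfl⟩ : ∃ w, v = w + k + 1 := ⟨v - k - 1, by ring⟩
  have e : w + k + 1 - k - 1 = w := by ring
  rw [e] at hv hpar ⊢
  -- In terms of the other eigenvalue `θ`, the parameters are `lam - mu = s + θ`, `k - mu = -s θ`.
  obtain ⟨θ, hθ⟩ : ∃ θ, θ = lam - mu - s := ⟨_, rfl⟩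
  obtain rfl : mu = k + s * θ := by rw [hθ]; linear_combination hs
  obtain rfl : lam = k + s * θ + s + θ := by linear_combination -hθ
  have hR : w * (k + s * θ) + k * (s + 1) * (θ + 1) = 0 := by linear_combination -hpar
  have e2 : k + s * θ + s + θ - (k + s * θ) - 2 * s = θ - s := by ring
  have e3 : k + s * θ + s + θ - (k + s * θ) = θ + s := by ring
  rw [e2] at hr
  rw [e2, e3]
  have hr' := hr.ne'
  field_simp
  linear_combination 2 * (s * w + k * (s + 1)) * hR

end Parameters

/-! ### Symmetric idempotents as Gram matrices -/

/-- A symmetric idempotent real matrix is the Gram matrix of vectors in a Euclidean space whose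
dimension is its trace. -/
lemma exists_vectors_of_isIdempotent {V : Type*} [Fintype V] [DecidableEq V] (P : Matrix V V ℝ)
    (hsymm : Pᵀ = P) (hP : P * P = P) :
    ∃ n : ℕ, (n : ℝ) = P.trace ∧ ∃ x : V → Fin n → ℝ, ∀ u w, x u ⬝ᵥ x w = P u w := by
  set T : EuclideanSpace ℝ V →ₗ[ℝ] EuclideanSpace ℝ V :=
    Matrix.toLin (EuclideanSpace.basisFun V ℝ).toBasis (EuclideanSpace.basisFun V ℝ).toBasis P
    with hT
  have hidem : IsIdempotentElem T := by
    change T ∘ₗ T = T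
    rw [hT, ← Matrix.toLin_mul, hP]
  refine ⟨Module.finrank ℝ T.range, ?_, fun u =>
    ((stdOrthonormalBasis ℝ T.range).repr
      ⟨T (EuclideanSpace.basisFun V ℝ u), LinearMap.mem_range_self _ _⟩).ofLp, fun u w => ?_⟩
  · rw [← (LinearMap.IsIdempotentElem.isProj_range T hidem).trace, hT, Matrix.trace_toLin_eq]
  · have hcol : ∀ u i, (T (EuclideanSpace.basisFun V ℝ u)).ofLp i = P i u := by
      intro u i
      have := Matrix.toLin_self (EuclideanSpace.basisFun V ℝ).toBasis
        (EuclideanSpace.basisFun V ℝ).toBasis P u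
      simp only [OrthonormalBasis.coe_toBasis] at this
      rw [hT, this]
      simp [Pi.single_apply]
    have h := (stdOrthonormalBasis ℝ T.range).repr.inner_map_map
      ⟨T (EuclideanSpace.basisFun V ℝ w), LinearMap.mem_range_self _ _⟩
      ⟨T (EuclideanSpace.basisFun V ℝ u), LinearMap.mem_range_self _ _⟩
    rw [EuclideanSpace.inner_eq_star_dotProduct] at h
    simp only [star_trivial] at h
    rw [h, Submodule.coe_inner, EuclideanSpace.inner_eq_star_dotProduct]
    have h2 : (P * P) u w = P u w := by rw [hP]
    rw [← h2, Matrix.mul_apply]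
    simp only [star_trivial, dotProduct, hcol]
    refine Finset.sum_congr rfl fun i _ => ?_
    rw [← Matrix.transpose_apply P u i, hsymm]

/-! ### The Euclidean representation -/

section Gram

variable {V : Type*} [DecidableEq V] {G : SimpleGraph V} [DecidableRel G.Adj] {v k lam mu : ℕ}

/-- The Gram matrix `I + p A + q (J - I - A)` of the Euclidean representation. -/
noncomputable def gram (G : SimpleGraph V) [DecidableRel G.Adj] (v k lam mu : ℕ) :
    Matrix V V ℝ := Matrix.of fun a b =>
  if a = b then 1 else if G.Adj a b then SRG.p k lam mu else SRG.q v k lam mu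

lemma gram_apply (a b : V) : gram G v k lam mu a b =
    (1 - SRG.q v k lam mu) * (1 : Matrix V V ℝ) a b
      + (SRG.p k lam mu - SRG.q v k lam mu) * G.adjMatrix ℝ a b + SRG.q v k lam mu := by
  by_cases hab : a = b
  · subst hab; simp [gram]
  · by_cases hadj : G.Adj a b <;> simp [gram, hab, hadj]

lemma gram_self (a : V) : gram G v k lam mu a a = 1 := by simp [gram]

lemma gram_of_adj {a b : V} (h : G.Adj a b) : gram G v k lam mu a b = SRG.p k lam mu := by
  simp [gram, h, h.ne]

lemma gram_of_not_adj {a b : V} (h : a ≠ b) (h' : ¬ G.Adj a b) :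
    gram G v k lam mu a b = SRG.q v k lam mu := by
  simp [gram, h, h']

lemma gram_symm (a b : V) : gram G v k lam mu a b = gram G v k lam mu b a := by
  simp [gram, eq_comm, G.adj_comm]

end Gram

lemma sum_adjMatrix {V : Type*} [Fintype V] {G : SimpleGraph V} [DecidableRel G.Adj]
    {v k lam mu : ℕ} (hG : G.IsSRGWith v k lam mu) (a : V) : ∑ b, G.adjMatrix ℝ a b = k := by
  have := SimpleGraph.adjMatrix_mulVec_const_apply_of_regular (α := ℝ) (a := 1) hG.regular (v := a)
  simpa only [Matrix.mulVec, dotProduct, Function.const_apply, mul_one] using this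

lemma sum_sum_adjMatrix {V : Type*} [Fintype V] {G : SimpleGraph V} [DecidableRel G.Adj]
    {v k lam mu : ℕ} (hG : G.IsSRGWith v k lam mu) :
    ∑ a, ∑ b, G.adjMatrix ℝ a b = v * k := by
  simp only [sum_adjMatrix hG, Finset.sum_const, Finset.card_univ, hG.card, nsmul_eq_mul]

variable {V : Type*} [Fintype V] [DecidableEq V] {G : SimpleGraph V} [DecidableRel G.Adj]
  {v k lam mu : ℕ}

/-- Common neighbours, counted by the adjacency matrix. -/
lemma sum_adjMatrix_mul (hG : G.IsSRGWith v k lam mu) (a b : V) :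
    ∑ c, G.adjMatrix ℝ a c * G.adjMatrix ℝ c b
      = k * (1 : Matrix V V ℝ) a b + lam * G.adjMatrix ℝ a b
        + mu * (1 - (1 : Matrix V V ℝ) a b - G.adjMatrix ℝ a b) := by
  have h := congrFun (congrFun (hG.matrix_eq (α := ℝ)) a) b
  rw [pow_two, Matrix.mul_apply] at h
  rw [h, Matrix.add_apply, Matrix.add_apply, Matrix.smul_apply, Matrix.smul_apply,
    Matrix.smul_apply, nsmul_eq_mul, nsmul_eq_mul, nsmul_eq_mul]
  by_cases hab : a = b
  · subst hab; simp
  · by_cases hadj : G.Adj a b <;> simp [hab, hadj]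

lemma param_eq (hG : G.IsSRGWith v k lam mu) [Nonempty V] :
    (k : ℝ) * (k - lam - 1) = (v - k - 1) * mu := by
  obtain ⟨a⟩ := ‹Nonempty V›
  have h : ∑ b, ∑ c, G.adjMatrix ℝ a c * G.adjMatrix ℝ c b = (k : ℝ) * k := by
    rw [Finset.sum_comm]
    simp only [← Finset.mul_sum, sum_adjMatrix hG, ← Finset.sum_mul]
  simp only [sum_adjMatrix_mul hG, Finset.sum_add_distrib, ← Finset.mul_sum,
    Finset.sum_sub_distrib, sum_adjMatrix hG, Matrix.one_apply, Finset.sum_ite_eq,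
    Finset.mem_univ, if_true, Finset.sum_const, Finset.card_univ, hG.card, nsmul_eq_mul,
    mul_one] at h
  linear_combination -h

/-- Numerical consequences of being neither complete nor edgeless. -/
lemma param_bounds (hG : G.IsSRGWith v k lam mu) (htop : G ≠ ⊤) (hbot : G ≠ ⊥) :
    0 < k ∧ k + 1 < v ∧ mu ≤ k ∧ lam < k := by
  obtain ⟨a, b, hab⟩ : ∃ a b, G.Adj a b := SimpleGraph.ne_bot_iff_exists_adj.1 hbot
  obtain ⟨c, d, hcd, hncd⟩ : ∃ c d, c ≠ d ∧ ¬ G.Adj c d := by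
    by_contra! h
    exact htop (by ext c d; exact ⟨fun h' => h'.ne, fun h' => h c d h'⟩)
  have hcard : ∀ x y, Fintype.card (G.commonNeighbors x y)
      = (G.neighborFinset x ∩ G.neighborFinset y).card := by
    intro x y
    exact Fintype.card_of_finset' _ (by simp [SimpleGraph.commonNeighbors])
  have hdeg : ∀ x, (G.neighborFinset x).card = k := fun x => hG.regular x
  refine ⟨?_, ?_, ?_, ?_⟩
  · rw [← hdeg a]
    exact Finset.card_pos.2 ⟨b, by simpa using hab⟩
  · have h : (insert c (insert d (G.neighborFinset c))).card ≤ v := hG.card ▸ Finset.card_le_univ _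
    rw [Finset.card_insert_of_notMem, Finset.card_insert_of_notMem, hdeg] at h
    · omega
    · simpa using hncd
    · simpa using hcd
  · rw [← hG.of_not_adj hcd hncd, hcard, ← hdeg c]
    exact Finset.card_le_card Finset.inter_subset_left
  · rw [← hG.of_adj a b hab, hcard, ← hdeg a]
    refine Finset.card_lt_card ⟨Finset.inter_subset_left, fun h => ?_⟩
    have : b ∈ G.neighborFinset a ∩ G.neighborFinset b := h (by simpa using hab)
    simp at this

lemma gram_mul_self (hG : G.IsSRGWith v k lam mu) (htop : G ≠ ⊤) (hbot : G ≠ ⊥) :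
    gram G v k lam mu * gram G v k lam mu
      = gramScale v k lam mu • gram G v k lam mu := by
  obtain ⟨hk, hv, hmu, hlam⟩ := param_bounds hG htop hbot
  have hne : Nonempty V := Fintype.card_pos_iff.1 (by rw [hG.card]; omega)
  have hk' : (0 : ℝ) < k := by exact_mod_cast hk
  have hv' : (0 : ℝ) < v - k - 1 := by
    have : (k : ℝ) + 1 < v := by exact_mod_cast hv
    linarith
  have hmu' : (mu : ℝ) ≤ k := by exact_mod_cast hmu
  have hpar := param_eq hG
  have h1 := one_sub_q_eq hk' hv' hmu' hpar
  have h2 := q_mul_eq hk' hv' hmu' hpar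
  have hs := s_sq (lam := lam) hmu'
  have hp := mul_p (lam := lam) (mu := mu) hk'
  have hq := mul_q (lam := lam) (mu := mu) hv'
  -- The columns of the Gram matrix are orthogonal to the all-ones vector and are `s`-eigenvectors
  -- of the adjacency matrix.
  have hJ : ∀ b, ∑ c, gram G v k lam mu c b = 0 := by
    intro b
    simp only [gram_symm _ b]
    simp only [gram_apply, Finset.sum_add_distrib, ← Finset.mul_sum, sum_adjMatrix hG,
      Matrix.one_apply, Finset.sum_ite_eq, Finset.mem_univ, if_true, Finset.sum_const,
      Finset.card_univ, hG.card, nsmul_eq_mul]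
    linear_combination hp + hq
  have hA : ∀ a b, ∑ c, G.adjMatrix ℝ a c * gram G v k lam mu c b
      = SRG.s k lam mu * gram G v k lam mu a b := by
    intro a b
    have e : ∀ c, G.adjMatrix ℝ a c * gram G v k lam mu c b
        = (1 - SRG.q v k lam mu) * (G.adjMatrix ℝ a c * (1 : Matrix V V ℝ) c b)
          + (SRG.p k lam mu - SRG.q v k lam mu) * (G.adjMatrix ℝ a c * G.adjMatrix ℝ c b)
          + SRG.q v k lam mu * G.adjMatrix ℝ a c := by
      intro c
      rw [gram_apply]
      ring
    simp only [e, Finset.sum_add_distrib, ← Finset.mul_sum, sum_adjMatrix hG,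
      sum_adjMatrix_mul hG]
    rw [← Matrix.mul_apply, mul_one, gram_apply]
    generalize (1 : Matrix V V ℝ) a b = d
    generalize G.adjMatrix ℝ a b = α
    generalize SRG.s k lam mu = s at *
    generalize SRG.p k lam mu = p at *
    generalize SRG.q v k lam mu = q at *
    linear_combination α * h1 + h2 - d * s * h1 - d * (p - q) * hs
  ext a b
  have e : ∀ c, gram G v k lam mu a c * gram G v k lam mu c b
      = (1 - SRG.q v k lam mu) * ((1 : Matrix V V ℝ) a c * gram G v k lam mu c b)
        + (SRG.p k lam mu - SRG.q v k lam mu) * (G.adjMatrix ℝ a c * gram G v k lam mu c b)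
        + SRG.q v k lam mu * gram G v k lam mu c b := by
    intro c
    rw [gram_apply a c]
    ring
  rw [Matrix.mul_apply]
  simp only [e, Finset.sum_add_distrib, ← Finset.mul_sum, hJ, hA]
  rw [← Matrix.mul_apply, one_mul, Matrix.smul_apply, gramScale, smul_eq_mul]
  ring

/-- The Euclidean representation: the Gram matrix is realized by vectors in `ℝᵍ`. -/
theorem exists_representation (hG : G.IsSRGWith v k lam mu) (htop : G ≠ ⊤) (hbot : G ≠ ⊥) :
    ∃ n : ℕ, 0 < n ∧ (n : ℝ) = SRG.g v k lam mu ∧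
      ∃ x : V → Fin n → ℝ, ∀ a b, x a ⬝ᵥ x b = gram G v k lam mu a b := by
  obtain ⟨hk, hv, hmu, hlam⟩ := param_bounds hG htop hbot
  have hne : Nonempty V := Fintype.card_pos_iff.1 (by rw [hG.card]; omega)
  have hk' : (0 : ℝ) < k := by exact_mod_cast hk
  have hv' : (0 : ℝ) < v - k - 1 := by
    have : (k : ℝ) + 1 < v := by exact_mod_cast hv
    linarith
  have hmu' : (mu : ℝ) ≤ k := by exact_mod_cast hmu
  have hlam' : (lam : ℝ) < k := by exact_mod_cast hlam
  have hg := g_mul_gramScale hk' hv' hmu' hlam' (param_eq hG)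
  have hc : 0 < gramScale v k lam mu := gramScale_pos hk' hv'
  set c := gramScale (v : ℝ) k lam mu with hcdef
  obtain ⟨n, hn, x, hx⟩ := exists_vectors_of_isIdempotent (c⁻¹ • gram G v k lam mu)
    (by ext a b; simp [gram_symm a b])
    (by
      rw [smul_mul_smul_comm, gram_mul_self hG htop hbot, smul_smul]
      congr 1
      rw [← hcdef]
      field_simp)
  have htr : (gram G v k lam mu).trace = v := by
    simp [Matrix.trace, gram_self, hG.card]
  have hng : (n : ℝ) = SRG.g v k lam mu := by
    rw [hn, Matrix.trace_smul, htr, smul_eq_mul]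
    field_simp
    linarith
  refine ⟨n, ?_, hng, fun a => √c • x a, fun a b => ?_⟩
  · have hv0 : (0 : ℝ) < v := by linarith
    have : (0 : ℝ) < n := by
      rw [hng]
      refine (mul_pos_iff_of_pos_right hc).1 ?_
      rwa [hg]
    exact_mod_cast this
  · rw [smul_dotProduct, dotProduct_smul, hx, Matrix.smul_apply]
    simp only [smul_eq_mul]
    rw [← mul_assoc, Real.mul_self_sqrt hc.le]
    field_simp

/-- If vectors at adjacent vertices are opposite and nonzero, their sign with respect to the
lexicographic order is a proper two-colouring. -/
lemma isBipartite_of_add_eq_zero {V : Type*} {G : SimpleGraph V} {n : ℕ}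
    (x : V → Fin n → ℝ) (hx : ∀ a, x a ≠ 0)
    (h : ∀ a b, G.Adj a b → x a + x b = 0) : G.IsBipartite := by
  classical
  refine ⟨SimpleGraph.Coloring.mk (fun a => if 0 < toLex (x a) then 0 else 1) ?_⟩
  intro a b hab
  have hb : toLex (x b) = -toLex (x a) := by
    rw [← toLex_neg, ← eq_neg_of_add_eq_zero_right (h a b hab)]
  have ha : toLex (x a) ≠ 0 := fun h0 => hx a (toLex_eq_zero.1 h0)
  rcases lt_or_gt_of_ne ha with h0 | h0
  · have h1 : 0 < toLex (x b) := hb ▸ neg_pos.2 h0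
    have h2 : ¬ 0 < toLex (x a) := not_lt_of_gt h0
    rw [if_neg h2, if_pos h1]
    decide
  · have h1 : ¬ 0 < toLex (x b) := hb ▸ not_lt_of_gt (neg_lt_zero.2 h0)
    have h2 : 0 < toLex (x a) := h0
    rw [if_pos h2, if_neg h1]
    decide

/-- If `p ≤ -1`, then `|x a + x b|² = 2 + 2p ≤ 0` for every edge `ab`, so adjacent vertices have
opposite vectors. -/
lemma neg_one_lt_p {V : Type*} [DecidableEq V] {G : SimpleGraph V} [DecidableRel G.Adj]
    {v k lam mu n : ℕ} (x : V → Fin n → ℝ)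
    (hx : ∀ a b, x a ⬝ᵥ x b = gram G v k lam mu a b) (hbip : ¬ G.IsBipartite) :
    -1 < SRG.p k lam mu := by
  by_contra! hp
  refine hbip (isBipartite_of_add_eq_zero x (fun a ha => ?_) fun a b hab => ?_)
  · have := hx a a
    rw [ha, gram_self] at this
    simp at this
  · have h : (x a + x b) ⬝ᵥ (x a + x b) = 2 + 2 * SRG.p k lam mu := by
      rw [add_dotProduct, dotProduct_add, dotProduct_add, hx, hx, hx, hx, gram_self, gram_self,
        gram_symm b a, gram_of_adj hab]
      ring
    have h0 : 0 ≤ (x a + x b) ⬝ᵥ (x a + x b) := Finset.sum_nonneg fun i _ => mul_self_nonneg _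
    exact dotProduct_self_eq_zero.1 (le_antisymm (by linarith) h0)

end SRGRepresentation

namespace SRGCounting

open SRGRepresentation

/-! ### Counting cliques -/

section Cliques

variable {V : Type*} [Fintype V]

lemma forall_fin_four_adj_iff {V : Type*} (G : SimpleGraph V) (f : Fin 4 → V) :
    (∀ i j, i ≠ j → G.Adj (f i) (f j)) ↔ G.Adj (f 0) (f 1) ∧ G.Adj (f 2) (f 3) ∧
      G.Adj (f 0) (f 2) ∧ G.Adj (f 0) (f 3) ∧ G.Adj (f 1) (f 2) ∧ G.Adj (f 1) (f 3) := by
  constructor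
  · intro h
    exact ⟨h 0 1 (by decide), h 2 3 (by decide), h 0 2 (by decide), h 0 3 (by decide),
      h 1 2 (by decide), h 1 3 (by decide)⟩
  · rintro ⟨h01, h23, h02, h03, h12, h13⟩ i j hij
    fin_cases i <;> fin_cases j <;> first
      | exact absurd rfl hij
      | exact h01 | exact h23 | exact h02 | exact h03 | exact h12 | exact h13
      | exact h01.symm | exact h23.symm | exact h02.symm | exact h03.symm | exact h12.symm
      | exact h13.symm

lemma sum_fin_succ_fun {n : ℕ} (F : (Fin (n + 1) → V) → ℝ) :
    ∑ f, F f = ∑ a, ∑ f : Fin n → V, F (Fin.cons a f) := by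
  rw [← (Fin.consEquiv fun _ => V).sum_comp, Fintype.sum_prod_type]
  rfl

variable [DecidableEq V] (G : SimpleGraph V) [DecidableRel G.Adj]

/-- Each clique with `n` vertices has `n!` enumerations. -/
lemma card_filter_pairwise_adj (n : ℕ) :
    (Finset.univ.filter fun f : Fin n → V => ∀ i j, i ≠ j → G.Adj (f i) (f j)).card
      = (G.cliqueFinset n).card * n.factorial := by
  have hinj : ∀ f : Fin n → V, (∀ i j, i ≠ j → G.Adj (f i) (f j)) → f.Injective := by
    intro f hf i j hij
    by_contra hne
    exact (hf i j hne).ne hij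
  rw [Finset.card_eq_sum_card_fiberwise (f := fun f => Finset.univ.image f)
    (t := G.cliqueFinset n)]
  · refine Finset.sum_const_nat fun s hs => ?_
    rw [SimpleGraph.mem_cliqueFinset_iff, SimpleGraph.isNClique_iff] at hs
    have hcard : Fintype.card (Fin n ↪ s) = n.factorial := by
      rw [Fintype.card_embedding_eq, Fintype.card_coe, hs.2, Fintype.card_fin,
        Nat.descFactorial_self]
    rw [← hcard, ← Finset.card_univ]
    symm
    refine Finset.card_bij (fun e _ i => (e i : V)) ?_ ?_ ?_
    · intro e _
      have he : (fun i => (e i : V)).Injective := fun i j h => e.injective (Subtype.ext h)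
      simp only [Finset.mem_filter, Finset.mem_univ, true_and]
      refine ⟨fun i j hij => hs.1 (e i).2 (e j).2 fun h => hij (he h), ?_⟩
      refine Finset.eq_of_subset_of_card_le ?_ ?_
      · intro x hx
        obtain ⟨i, _, rfl⟩ := Finset.mem_image.1 hx
        exact (e i).2
      · rw [Finset.card_image_of_injective _ he, hs.2, Finset.card_univ, Fintype.card_fin]
    · intro e _ e' _ h
      ext i
      exact congrFun h i
    · intro f hf
      simp only [Finset.mem_filter, Finset.mem_univ, true_and] at hf
      have hmem : ∀ i, f i ∈ s := fun i => hf.2 ▸ Finset.mem_image_of_mem f (Finset.mem_univ i)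
      exact ⟨⟨fun i => ⟨f i, hmem i⟩, fun i j h => hinj f hf.1 (congrArg Subtype.val h)⟩,
        Finset.mem_univ _, rfl⟩
  · intro f hf
    simp only [Finset.coe_filter, Finset.mem_univ, true_and, Set.mem_ofPred_eq] at hf
    simp only [Finset.mem_coe, SimpleGraph.mem_cliqueFinset_iff, SimpleGraph.isNClique_iff]
    refine ⟨?_, ?_⟩
    · intro x hx y hy hxy
      simp only [Finset.coe_image, Finset.coe_univ, Set.image_univ, Set.mem_range] at hx hy
      obtain ⟨i, rfl⟩ := hx
      obtain ⟨j, rfl⟩ := hy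
      exact hf i j fun h => hxy (h ▸ rfl)
    · rw [Finset.card_image_of_injective _ (hinj f hf), Finset.card_univ, Fintype.card_fin]

lemma sum_four_clique :
    ∑ a, ∑ b, G.adjMatrix ℝ a b * ∑ c, ∑ d, G.adjMatrix ℝ c d *
      (G.adjMatrix ℝ a c * G.adjMatrix ℝ a d * G.adjMatrix ℝ b c * G.adjMatrix ℝ b d)
      = 24 * ((G.cliqueFinset 4).card : ℝ) := by
  have h := card_filter_pairwise_adj G 4
  have h2 : ((Finset.univ.filter fun f : Fin 4 → V =>
      ∀ i j, i ≠ j → G.Adj (f i) (f j)).card : ℝ) = 24 * ((G.cliqueFinset 4).card : ℝ) := by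
    rw [h]
    push_cast [Nat.factorial]
    ring
  simp only [forall_fin_four_adj_iff] at h2
  rw [← h2, Finset.card_filter, Nat.cast_sum]
  simp only [sum_fin_succ_fun, Fintype.sum_unique, Finset.mul_sum]
  refine Finset.sum_congr rfl fun a _ => Finset.sum_congr rfl fun b _ =>
    Finset.sum_congr rfl fun c _ => Finset.sum_congr rfl fun d _ => ?_
  change _ = ((if G.Adj a b ∧ G.Adj c d ∧ G.Adj a c ∧ G.Adj a d ∧ G.Adj b c ∧ G.Adj b d
    then 1 else 0 : ℕ) : ℝ)
  simp only [SimpleGraph.adjMatrix_apply]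
  split_ifs <;> simp_all

end Cliques

/-! ### Edges disjoint from a given edge -/

section Entries

variable {V : Type*} {G : SimpleGraph V} [DecidableRel G.Adj]

lemma adjMatrix_comm (a b : V) : G.adjMatrix ℝ a b = G.adjMatrix ℝ b a := by
  simp [G.adj_comm]

lemma adjMatrix_mul_self (a b : V) : G.adjMatrix ℝ a b * G.adjMatrix ℝ a b = G.adjMatrix ℝ a b := by
  simp

lemma adjMatrix_self (a : V) : G.adjMatrix ℝ a a = 0 := by
  simp

lemma adjMatrix_of_adj {a b : V} (h : G.Adj a b) : G.adjMatrix ℝ a b = 1 := by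
  simp [h]

end Entries

variable {V : Type*} [Fintype V] [DecidableEq V] {G : SimpleGraph V} [DecidableRel G.Adj]

/-- The sum of `f` over the vertices other than `a` and `b`. -/
lemma sum_avoid {a b : V} (hab : a ≠ b) (f : V → ℝ) :
    ∑ c, (if c = a ∨ c = b then 0 else f c) = ∑ c, f c - f a - f b := by
  have h : ∀ c, (if c = a ∨ c = b then 0 else f c)
      = f c - (if a = c then f c else 0) - (if b = c then f c else 0) := by
    intro c
    by_cases h1 : a = c
    · subst h1; simp [hab.symm]
    · by_cases h2 : b = c
      · subst h2; simp [h1]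
      · simp [h1, h2, Ne.symm h1, Ne.symm h2]
  simp [h, Finset.sum_sub_distrib]

/-- The sum of `f c d` over the ordered edges `(c, d)` disjoint from `{a, b}`. -/
noncomputable def disjointSum (G : SimpleGraph V) [DecidableRel G.Adj] (a b : V)
    (f : V → V → ℝ) : ℝ :=
  ∑ c, if c = a ∨ c = b then 0 else
    ∑ d, if d = a ∨ d = b then 0 else G.adjMatrix ℝ c d * f c d

/-- Inclusion–exclusion over the edges that meet `{a, b}`. -/
lemma disjointSum_eq {a b : V} (hab : G.Adj a b) (f : V → V → ℝ) :
    disjointSum G a b f = ∑ c, ∑ d, G.adjMatrix ℝ c d * f c d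
      - ∑ c, G.adjMatrix ℝ a c * f c a - ∑ c, G.adjMatrix ℝ b c * f c b
      - ∑ d, G.adjMatrix ℝ a d * f a d - ∑ d, G.adjMatrix ℝ b d * f b d + f a b + f b a := by
  have h := adjMatrix_of_adj hab
  have h' := adjMatrix_of_adj hab.symm
  unfold disjointSum
  simp only [sum_avoid hab.ne, Finset.sum_sub_distrib, adjMatrix_self, h, h',
    adjMatrix_comm _ a, adjMatrix_comm _ b]
  ring

lemma disjointSum_congr {a b : V} {f f' : V → V → ℝ}
    (h : ∀ c d, c ≠ a → c ≠ b → d ≠ a → d ≠ b → G.Adj c d → f c d = f' c d) :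
    disjointSum G a b f = disjointSum G a b f' := by
  refine Finset.sum_congr rfl fun c _ => ?_
  split_ifs with hc
  · rfl
  · push Not at hc
    refine Finset.sum_congr rfl fun d _ => ?_
    split_ifs with hd
    · rfl
    · push Not at hd
      by_cases hcd : G.Adj c d
      · rw [h c d hc.1 hc.2 hd.1 hd.2 hcd]
      · simp [hcd]

lemma disjointSum_add (a b : V) (f f' : V → V → ℝ) :
    disjointSum G a b (fun c d => f c d + f' c d)
      = disjointSum G a b f + disjointSum G a b f' := by
  simp only [disjointSum, ← Finset.sum_add_distrib]
  refine Finset.sum_congr rfl fun c _ => ?_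
  split_ifs
  · simp
  · rw [← Finset.sum_add_distrib]
    refine Finset.sum_congr rfl fun d _ => ?_
    split_ifs <;> ring

lemma disjointSum_const_mul (a b : V) (r : ℝ) (f : V → V → ℝ) :
    disjointSum G a b (fun c d => r * f c d) = r * disjointSum G a b f := by
  simp only [disjointSum, Finset.mul_sum, mul_ite, mul_zero]
  refine Finset.sum_congr rfl fun c _ => ?_
  split_ifs
  · rfl
  · refine Finset.sum_congr rfl fun d _ => ?_
    split_ifs <;> ring

lemma disjointSum_flip (a b : V) (f : V → V → ℝ) :
    disjointSum G a b (fun c d => f d c) = disjointSum G a b f := by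
  have h : ∀ f : V → V → ℝ, disjointSum G a b f = ∑ c, ∑ d,
      if (c = a ∨ c = b) ∨ (d = a ∨ d = b) then 0 else G.adjMatrix ℝ c d * f c d := by
    intro f
    refine Finset.sum_congr rfl fun c _ => ?_
    by_cases hc : c = a ∨ c = b <;> simp [hc]
  rw [h, h, Finset.sum_comm]
  refine Finset.sum_congr rfl fun c _ => Finset.sum_congr rfl fun d _ => ?_
  rw [adjMatrix_comm c d]
  congr 1
  exact propext or_comm

lemma disjointSum_swap (a b : V) (f : V → V → ℝ) :
    disjointSum G b a f = disjointSum G a b f := by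
  simp only [disjointSum, or_comm]

/-! ### Moments of the adjacencies between two edges -/

variable {v k lam mu : ℕ}

local notation "A" => SimpleGraph.adjMatrix ℝ G

/-- Common neighbours of adjacent vertices. -/
lemma sum_adjMatrix_mul_adjMatrix_of_adj (hG : G.IsSRGWith v k lam mu) {a b : V}
    (hab : G.Adj a b) : ∑ c, A a c * A b c = lam := by
  have h := sum_adjMatrix_mul hG a b
  rw [adjMatrix_of_adj hab, Matrix.one_apply_ne hab.ne] at h
  simp only [adjMatrix_comm _ b] at h
  rw [h]
  ring

/-- The factor `A a c` restricts to `c` adjacent to `a`, where the sum counts `lam` vertices. -/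
lemma adjMatrix_mul_sum (hG : G.IsSRGWith v k lam mu) (a c : V) :
    A a c * ∑ d, A c d * A a d = lam * A a c := by
  by_cases h : G.Adj a c
  · rw [sum_adjMatrix_mul_adjMatrix_of_adj hG h.symm, mul_comm]
  · simp [h]

/-- The walks of length three from `a` to an adjacent vertex `b`. -/
lemma sum_adjMatrix_path (hG : G.IsSRGWith v k lam mu) {a b : V} (hab : G.Adj a b) :
    ∑ c, ∑ d, A c d * (A a c * A b d) = k + lam * lam + mu * (k - 1 - lam) := by
  have e : ∀ c, ∑ d, A c d * (A a c * A b d) = k * (A a c * (1 : Matrix V V ℝ) c b)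
      + lam * (A a c * A b c) + mu * (A a c - A a c * (1 : Matrix V V ℝ) c b - A a c * A b c) := by
    intro c
    have h := sum_adjMatrix_mul hG c b
    have h2 : ∑ d, A c d * (A a c * A b d) = A a c * ∑ d, A c d * A d b := by
      rw [Finset.mul_sum]
      refine Finset.sum_congr rfl fun d _ => ?_
      rw [adjMatrix_comm d b]
      ring
    rw [h2, h, adjMatrix_comm c b]
    ring
  simp only [e, Finset.sum_add_distrib, Finset.sum_sub_distrib, ← Finset.mul_sum,
    sum_adjMatrix hG, sum_adjMatrix_mul_adjMatrix_of_adj hG hab]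
  rw [← Matrix.mul_apply, mul_one, adjMatrix_of_adj hab]
  ring

section Moments

variable {a b : V}

lemma disjointSum_one (hG : G.IsSRGWith v k lam mu) (hab : G.Adj a b) :
    disjointSum G a b (fun _ _ => 1) = v * k - 4 * k + 2 := by
  rw [disjointSum_eq hab]
  simp only [mul_one, sum_sum_adjMatrix hG]
  simp only [sum_adjMatrix hG]
  ring

lemma disjointSum_adj (hG : G.IsSRGWith v k lam mu) (hab : G.Adj a b) :
    disjointSum G a b (fun c _ => A a c) = (k - 1) ^ 2 - lam := by
  have h1 : ∑ c, ∑ d, A c d * A a c = (k : ℝ) * k := by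
    simp only [← Finset.sum_mul, sum_adjMatrix hG, ← Finset.mul_sum]
  have h2 : ∑ c, A b c * A a c = lam := sum_adjMatrix_mul_adjMatrix_of_adj hG hab.symm
  rw [disjointSum_eq hab, h1, h2]
  simp only [adjMatrix_mul_self, adjMatrix_self, adjMatrix_of_adj hab, mul_one, mul_zero,
    Finset.sum_const_zero, sum_adjMatrix hG]
  ring

lemma disjointSum_adj_adj_fst (hG : G.IsSRGWith v k lam mu) (hab : G.Adj a b) :
    disjointSum G a b (fun c d => A a c * A a d) = lam * (k - 2) := by
  have h1 : ∑ c, ∑ d, A c d * (A a c * A a d) = (lam : ℝ) * k := by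
    have e : ∀ c, ∑ d, A c d * (A a c * A a d) = lam * A a c := by
      intro c
      rw [← adjMatrix_mul_sum hG, Finset.mul_sum]
      exact Finset.sum_congr rfl fun d _ => by ring
    simp only [e, ← Finset.mul_sum, sum_adjMatrix hG]
  have h2 : ∑ c, A b c * A a c = lam := sum_adjMatrix_mul_adjMatrix_of_adj hG hab.symm
  rw [disjointSum_eq hab, h1]
  simp only [adjMatrix_self, adjMatrix_of_adj hab, mul_one, one_mul, mul_zero, zero_mul,
    Finset.sum_const_zero, h2]
  ring

lemma disjointSum_adj_adj_snd (hG : G.IsSRGWith v k lam mu) (hab : G.Adj a b) :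
    disjointSum G a b (fun c _ => A a c * A b c) = lam * (k - 2) := by
  have h2 : ∑ c, A a c * A b c = lam := sum_adjMatrix_mul_adjMatrix_of_adj hG hab
  have h1 : ∑ c, ∑ d, A c d * (A a c * A b c) = (lam : ℝ) * k := by
    simp only [← Finset.sum_mul, sum_adjMatrix hG, ← Finset.mul_sum, h2]
    ring
  have e1 : ∀ c, A a c * (A a c * A b c) = A a c * A b c := fun c => by
    rw [← mul_assoc, adjMatrix_mul_self]
  have e2 : ∀ c, A b c * (A a c * A b c) = A a c * A b c := fun c => by
    rw [mul_left_comm, adjMatrix_mul_self]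
  rw [disjointSum_eq hab, h1]
  simp only [e1, e2, h2, adjMatrix_self, mul_zero, zero_mul, Finset.sum_const_zero]
  ring

/-- The four-cycles through the edge `ab`. -/
lemma disjointSum_cycle (hG : G.IsSRGWith v k lam mu) (hab : G.Adj a b) :
    disjointSum G a b (fun c d => A a c * A b d)
      = lam * (lam - 1) + (k - 1 - lam) * (mu - 1) := by
  rw [disjointSum_eq hab, sum_adjMatrix_path hG hab]
  simp only [adjMatrix_self, adjMatrix_of_adj hab, adjMatrix_of_adj hab.symm, mul_one, one_mul,
    adjMatrix_mul_self, mul_zero, zero_mul, Finset.sum_const_zero, sum_adjMatrix hG]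
  ring

/-- The four-cliques minus an edge, where the pair `b, d` is not required to be nonadjacent. -/
lemma disjointSum_diamond (hG : G.IsSRGWith v k lam mu) (hab : G.Adj a b) :
    disjointSum G a b (fun c d => A a c * A a d * A b c) = lam * (lam - 1) := by
  have h2 : ∑ c, A a c * A b c = lam := sum_adjMatrix_mul_adjMatrix_of_adj hG hab
  have h1 : ∑ c, ∑ d, A c d * (A a c * A a d * A b c) = (lam : ℝ) * lam := by
    have e : ∀ c, ∑ d, A c d * (A a c * A a d * A b c) = lam * (A a c * A b c) := by
      intro c
      rw [← mul_assoc, ← adjMatrix_mul_sum hG, Finset.mul_sum, Finset.sum_mul]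
      exact Finset.sum_congr rfl fun d _ => by ring
    simp only [e, ← Finset.mul_sum, h2]
  have e2 : ∀ c, A b c * (A a c * A b c) = A a c * A b c := fun c => by
    rw [mul_left_comm, adjMatrix_mul_self]
  rw [disjointSum_eq hab, h1]
  simp only [adjMatrix_self, adjMatrix_of_adj hab, mul_one, mul_zero, zero_mul,
    Finset.sum_const_zero, e2, h2]
  ring

lemma disjointSum_clique (hab : G.Adj a b) :
    disjointSum G a b (fun c d => A a c * A a d * A b c * A b d)
      = ∑ c, ∑ d, A c d * (A a c * A a d * A b c * A b d) := by
  rw [disjointSum_eq hab]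
  simp only [adjMatrix_self, mul_zero, zero_mul, Finset.sum_const_zero]
  ring

/-- A function of the number of adjacencies between `{a, b}` and `{c, d}` is a combination of the
elementary symmetric functions of the four adjacency indicators, with the finite differences of the
function as coefficients. -/
lemma disjointSum_adjacency_count (hG : G.IsSRGWith v k lam mu) (hab : G.Adj a b)
    (f : V → V → ℝ) (F : ℕ → ℝ)
    (hf : ∀ c d, c ≠ a → c ≠ b → d ≠ a → d ≠ b → G.Adj c d →
      f c d = F ((if G.Adj a c then 1 else 0) + (if G.Adj a d then 1 else 0)
        + (if G.Adj b c then 1 else 0) + (if G.Adj b d then 1 else 0))) :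
    disjointSum G a b f =
      F 0 * (v * k - 4 * k + 2)
      + (F 1 - F 0) * (4 * ((k - 1) ^ 2 - lam))
      + (F 2 - 2 * F 1 + F 0) * (4 * (lam * (k - 2))
          + 2 * (lam * (lam - 1) + (k - 1 - lam) * (mu - 1)))
      + (F 3 - 3 * F 2 + 3 * F 1 - F 0) * (4 * (lam * (lam - 1)))
      + (F 4 - 4 * F 3 + 6 * F 2 - 4 * F 1 + F 0) *
          ∑ c, ∑ d, A c d * (A a c * A a d * A b c * A b d) := by
  set S := disjointSum G a b
  have hac : S (fun c _ => A a c) = (k - 1) ^ 2 - lam := disjointSum_adj hG hab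
  have had : S (fun _ d => A a d) = (k - 1) ^ 2 - lam := by
    rw [← hac]; exact disjointSum_flip a b fun c _ => A a c
  have hbc : S (fun c _ => A b c) = (k - 1) ^ 2 - lam := by
    rw [← disjointSum_adj hG hab.symm]; exact disjointSum_swap b a _
  have hbd : S (fun _ d => A b d) = (k - 1) ^ 2 - lam := by
    rw [← hbc]; exact disjointSum_flip a b fun c _ => A b c
  have hacad : S (fun c d => A a c * A a d) = lam * (k - 2) := disjointSum_adj_adj_fst hG hab
  have hbcbd : S (fun c d => A b c * A b d) = lam * (k - 2) := by
    rw [← disjointSum_adj_adj_fst hG hab.symm]; exact disjointSum_swap b a _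
  have hacbc : S (fun c _ => A a c * A b c) = lam * (k - 2) := disjointSum_adj_adj_snd hG hab
  have hadbd : S (fun _ d => A a d * A b d) = lam * (k - 2) := by
    rw [← hacbc]; exact disjointSum_flip a b fun c _ => A a c * A b c
  have hacbd : S (fun c d => A a c * A b d)
      = lam * (lam - 1) + (k - 1 - lam) * (mu - 1) := disjointSum_cycle hG hab
  have hadbc : S (fun c d => A a d * A b c)
      = lam * (lam - 1) + (k - 1 - lam) * (mu - 1) := by
    rw [← hacbd]; exact disjointSum_flip a b fun c d => A a c * A b d
  have h3 : S (fun c d => A a c * A a d * A b c) = lam * (lam - 1) := disjointSum_diamond hG hab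
  have h3' : S (fun c d => A a d * A a c * A b d) = lam * (lam - 1) := by
    rw [← h3]; exact disjointSum_flip a b fun c d => A a c * A a d * A b c
  have h3'' : S (fun c d => A b c * A b d * A a c) = lam * (lam - 1) := by
    rw [← disjointSum_diamond hG hab.symm]; exact disjointSum_swap b a _
  have h3''' : S (fun c d => A b d * A b c * A a d) = lam * (lam - 1) := by
    rw [← h3'']; exact disjointSum_flip a b fun c d => A b c * A b d * A a c
  have h4 := disjointSum_clique hab
  have hexp : S f = S (fun c d => F 0 * 1
      + (F 1 - F 0) * (A a c + A a d + A b c + A b d)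
      + (F 2 - 2 * F 1 + F 0) * (A a c * A a d + A b c * A b d + A a c * A b c + A a d * A b d
          + A a c * A b d + A a d * A b c)
      + (F 3 - 3 * F 2 + 3 * F 1 - F 0) * (A a c * A a d * A b c + A a d * A a c * A b d
          + A b c * A b d * A a c + A b d * A b c * A a d)
      + (F 4 - 4 * F 3 + 6 * F 2 - 4 * F 1 + F 0) * (A a c * A a d * A b c * A b d)) := by
    refine disjointSum_congr fun c d h1 h2 h3 h4 h5 => ?_
    rw [hf c d h1 h2 h3 h4 h5]
    simp only [SimpleGraph.adjMatrix_apply]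
    split_ifs <;> norm_num <;> ring
  rw [hexp]
  simp only [S, disjointSum_add, disjointSum_const_mul] at *
  rw [disjointSum_one hG hab, hac, had, hbc, hbd, hacad, hbcbd, hacbc, hadbd, hacbd, hadbc,
    h3, h3', h3'', h3''', h4]
  ring

end Moments

/-! ### Sums over the Gram matrix -/

local notation "M" => gram G v k lam mu
local notation "p" => SRG.p k lam mu
local notation "q" => SRG.q v k lam mu

lemma sum_sum_gram (hG : G.IsSRGWith v k lam mu) (f : ℝ → ℝ) :
    ∑ a, ∑ b, f (M a b) = v * (f 1 + k * f p + (v - k - 1) * f q) := by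
  have e : ∀ a b, f (M a b) = f q + A a b * (f p - f q)
      + (1 : Matrix V V ℝ) a b * (f 1 - f q) := by
    intro a b
    by_cases hab : a = b
    · subst hab; simp [gram_self]
    · by_cases h : G.Adj a b
      · simp [gram_of_adj h, h, hab]
      · simp [gram_of_not_adj hab h, h, hab]
  simp only [e, Finset.sum_add_distrib, ← Finset.sum_mul, sum_adjMatrix hG, Matrix.one_apply,
    Finset.sum_ite_eq, Finset.mem_univ, if_true, Finset.sum_const, Finset.card_univ, hG.card,
    nsmul_eq_mul]
  ring

variable {a b : V}

/-- The inner products of all vertices with the sum of the two vectors of an edge `ab`. -/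
lemma sum_gram_add_gram (hG : G.IsSRGWith v k lam mu) (hab : G.Adj a b) (f : ℝ → ℝ) :
    ∑ u, f (M u a + M u b) = 2 * f (1 + p) + lam * f (2 * p) + 2 * (k - 1 - lam) * f (p + q)
      + (v - 2 * k + lam) * f (2 * q) := by
  have h1 := sum_avoid hab.ne fun u => f (M u a + M u b)
  have h2 := sum_avoid hab.ne fun u => f (2 * q) + (f (p + q) - f (2 * q)) * (A a u + A b u)
    + (f (2 * p) - 2 * f (p + q) + f (2 * q)) * (A a u * A b u)
  have e : ∀ u, (if u = a ∨ u = b then 0 else f (M u a + M u b))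
      = if u = a ∨ u = b then 0 else
        f (2 * q) + (f (p + q) - f (2 * q)) * (A a u + A b u)
          + (f (2 * p) - 2 * f (p + q) + f (2 * q)) * (A a u * A b u) := by
    intro u
    split_ifs with hu
    · rfl
    · push Not at hu
      by_cases hua : G.Adj u a <;> by_cases hub : G.Adj u b
      · simp [gram_of_adj hua, gram_of_adj hub, hua.symm, hub.symm, ← two_mul]
        ring
      · have := mt SimpleGraph.Adj.symm hub
        simp [gram_of_adj hua, gram_of_not_adj hu.2 hub, hua.symm, this]
      · have := mt SimpleGraph.Adj.symm hua
        simp [gram_of_adj hub, gram_of_not_adj hu.1 hua, hub.symm, this, add_comm q p]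
      · have h3 := mt SimpleGraph.Adj.symm hub
        have h4 := mt SimpleGraph.Adj.symm hua
        simp [gram_of_not_adj hu.2 hub, gram_of_not_adj hu.1 hua, h3, h4, ← two_mul]
  simp only [e] at h1
  simp only [h2, Finset.sum_add_distrib, ← Finset.mul_sum, sum_adjMatrix hG,
    sum_adjMatrix_mul_adjMatrix_of_adj hG hab, Finset.sum_const, Finset.card_univ, hG.card,
    nsmul_eq_mul, adjMatrix_self, adjMatrix_of_adj hab, adjMatrix_of_adj hab.symm, gram_self,
    gram_of_adj hab, gram_of_adj hab.symm, add_comm p 1] at h1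
  linear_combination -h1

/-- The edges that share the vertex `a` with the edge `ab`. -/
lemma sum_gram_incident (hG : G.IsSRGWith v k lam mu) (hab : G.Adj a b) (f : ℝ → ℝ) :
    ∑ c, A a c * f (M a c + M a a + M b c + M b a)
      = f (2 + 2 * p) + lam * f (1 + 3 * p) + (k - lam - 1) * f (1 + 2 * p + q) := by
  have e : ∀ c, A a c * f (M a c + M a a + M b c + M b a)
      = f (1 + 2 * p + q) * A a c + (f (1 + 3 * p) - f (1 + 2 * p + q)) * (A a c * A b c)
        + (f (2 + 2 * p) - f (1 + 2 * p + q)) * (A a c * (1 : Matrix V V ℝ) c b) := by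
    intro c
    by_cases hac : G.Adj a c
    · rw [gram_of_adj hac, gram_self, gram_of_adj hab.symm, adjMatrix_of_adj hac]
      by_cases hbc : c = b
      · subst hbc
        rw [gram_self, adjMatrix_self, Matrix.one_apply_eq,
          show p + 1 + 1 + p = 2 + 2 * p by ring]
        ring
      · rw [Matrix.one_apply_ne hbc]
        by_cases h : G.Adj b c
        · rw [gram_of_adj h, adjMatrix_of_adj h, show p + 1 + p + p = 1 + 3 * p by ring]
          ring
        · rw [gram_of_not_adj (Ne.symm hbc) h, show p + 1 + q + p = 1 + 2 * p + q by ring]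
          simp [h]
    · simp [hac]
  simp only [e, Finset.sum_add_distrib, ← Finset.mul_sum, sum_adjMatrix hG,
    sum_adjMatrix_mul_adjMatrix_of_adj hG hab]
  rw [← Matrix.mul_apply, mul_one, adjMatrix_of_adj hab]
  ring

/-- The inner products of all edges with a given edge `ab`, where an edge stands for the sum of the
two vectors at its ends. -/
lemma sum_gram_edge (hG : G.IsSRGWith v k lam mu) (hab : G.Adj a b) (f : ℝ → ℝ) :
    ∑ c, ∑ d, A c d * f (M a c + M a d + M b c + M b d)
      = 2 * f (2 + 2 * p) + 4 * lam * f (1 + 3 * p) + 4 * (k - lam - 1) * f (1 + 2 * p + q)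
      + f (4 * q) * (v * k - 4 * k + 2)
      + (f (p + 3 * q) - f (4 * q)) * (4 * ((k - 1) ^ 2 - lam))
      + (f (2 * p + 2 * q) - 2 * f (p + 3 * q) + f (4 * q)) * (4 * (lam * (k - 2))
          + 2 * (lam * (lam - 1) + (k - 1 - lam) * (mu - 1)))
      + (f (3 * p + q) - 3 * f (2 * p + 2 * q) + 3 * f (p + 3 * q) - f (4 * q))
          * (4 * (lam * (lam - 1)))
      + (f (4 * p) - 4 * f (3 * p + q) + 6 * f (2 * p + 2 * q) - 4 * f (p + 3 * q) + f (4 * q)) *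
          ∑ c, ∑ d, A c d * (A a c * A a d * A b c * A b d) := by
  -- The edges disjoint from `ab` are counted by adjacencies; the remaining ones meet `a` or `b`.
  set F : ℕ → ℝ := fun i => f (i * p + (4 - i) * q) with hF
  have hD := disjointSum_adjacency_count hG hab (fun c d => f (M a c + M a d + M b c + M b d)) F (by
    intro c d hca hcb hda hdb _
    have e : ∀ {x y : V}, y ≠ x → M x y = q + (if G.Adj x y then 1 else 0) * (p - q) := by
      intro x y hxy
      by_cases h : G.Adj x y
      · simp [gram_of_adj h, h]
      · simp [gram_of_not_adj hxy.symm h, h]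
    simp only [hF]
    rw [e hca, e hcb, e hda, e hdb]
    push_cast
    congr 1
    ring)
  have hF0 : F 0 = f (4 * q) := by simp only [hF]; congr 1; push_cast; ring
  have hF1 : F 1 = f (p + 3 * q) := by simp only [hF]; congr 1; push_cast; ring
  have hF2 : F 2 = f (2 * p + 2 * q) := by simp only [hF]; congr 1; push_cast; ring
  have hF3 : F 3 = f (3 * p + q) := by simp only [hF]; congr 1; push_cast; ring
  have hF4 : F 4 = f (4 * p) := by simp only [hF]; congr 1; push_cast; ring
  rw [hF0, hF1, hF2, hF3, hF4, disjointSum_eq hab] at hD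
  have ha := sum_gram_incident hG hab f
  have hb := sum_gram_incident hG hab.symm f
  have e1 : ∀ c, f (M a a + M a c + M b a + M b c) = f (M a c + M a a + M b c + M b a) :=
    fun c => by congr 1; ring
  have e2 : ∀ c, f (M a c + M a b + M b c + M b b) = f (M b c + M b b + M a c + M a b) :=
    fun c => by congr 1; ring
  have e3 : ∀ c, f (M a b + M a c + M b b + M b c) = f (M b c + M b b + M a c + M a b) :=
    fun c => by congr 1; ring
  have e4 : f (M b a + M b b + M a a + M a b) = f (2 + 2 * p) := by
    rw [gram_self, gram_self, gram_of_adj hab, gram_of_adj hab.symm]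
    congr 1
    ring
  simp only [e1, e2, e3] at hD
  rw [ha, hb] at hD
  simp only [e4] at hD
  linear_combination hD

end SRGCounting

/-! ### The inequality -/

theorem mainTheorem2 {V : Type*} [Fintype V] [DecidableEq V]
    (G : SimpleGraph V) [DecidableRel G.Adj] (v k lam mu : ℕ)
    (hG : G.IsSRGWith v k lam mu)
    -- `G` is not complete
    (hcomplete : G ≠ ⊤)
    -- `G` is not bipartite; in particular it has an edge
    (hbip : ¬ G.IsBipartite)
    (t : ℕ) (ht : 0 < t) :
    SRG.PsiB v k lam mu t ^ 2 ≤
      SRG.PsiA v k lam mu t *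
        (SRG.PsiC0 v k lam mu t + ((G.cliqueFinset 4).card : ℝ) * SRG.PsiC1 v k lam mu t) := by
  have hbot : G ≠ ⊥ := by
    rintro rfl
    exact hbip ⟨SimpleGraph.Coloring.mk (fun _ => 0) (fun h => h.elim)⟩
  obtain ⟨hk, hv, _, _⟩ := SRGRepresentation.param_bounds hG hcomplete hbot
  have hne : Nonempty V := Fintype.card_pos_iff.1 (by rw [hG.card]; omega)
  have hpar := SRGRepresentation.param_eq hG
  obtain ⟨n, hn, hng, x, hx⟩ := SRGRepresentation.exists_representation hG hcomplete hbot
  have hp := SRGRepresentation.neg_one_lt_p x hx hbip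
  have hp2 : 0 < 2 + 2 * SRG.p k lam mu := by linarith
  set p := SRG.p (k : ℝ) lam mu with hpdef
  set q := SRG.q (v : ℝ) k lam mu with hqdef
  set M := SRGRepresentation.gram G v k lam mu with hM
  set Zg := SRG.Z n t with hZg
  set r := √(2 + 2 * p) with hr
  have hrr : r * r = 2 + 2 * p := Real.mul_self_sqrt hp2.le
  have hr0 : r ≠ 0 := (Real.sqrt_pos.2 hp2).ne'
  -- The unit vectors in the directions of the edges.
  set y : V × V → Fin n → ℝ := fun e => r⁻¹ • (x e.1 + x e.2) with hy
  have hxy : ∀ u e, x u ⬝ᵥ y e = (M u e.1 + M u e.2) / r := by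
    intro u e
    simp only [hy, dotProduct_smul, dotProduct_add, hx, smul_eq_mul]
    field_simp
  have hyx : ∀ u e, y e ⬝ᵥ x u = (M u e.1 + M u e.2) / r := fun u e => by
    rw [dotProduct_comm, hxy]
  have hyy : ∀ e f, y e ⬝ᵥ y f
      = (M e.1 f.1 + M e.1 f.2 + M e.2 f.1 + M e.2 f.2) / (2 + 2 * p) := by
    intro e f
    simp only [hy, dotProduct_smul, smul_dotProduct, dotProduct_add, add_dotProduct, hx,
      smul_eq_mul]
    rw [← hrr]
    field_simp
    ring
  have hA : ∑ a, ∑ b, Zg (M a b) = SRG.PsiA v k lam mu t := by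
    rw [SRGCounting.sum_sum_gram hG Zg, SRG.PsiA, ← hng]
  -- Each edge is counted once in each orientation, hence the factors `2` and `4`.
  have hB : ∑ u, ∑ e : V × V, G.adjMatrix ℝ e.1 e.2 * Zg ((M u e.1 + M u e.2) / r)
      = 2 * SRG.PsiB v k lam mu t := by
    have h : ∀ e : V × V, ∑ u, G.adjMatrix ℝ e.1 e.2 * Zg ((M u e.1 + M u e.2) / r)
        = G.adjMatrix ℝ e.1 e.2 * (2 * Zg ((1 + p) / r) + lam * Zg (2 * p / r)
          + 2 * (k - 1 - lam) * Zg ((p + q) / r) + (v - 2 * k + lam) * Zg (2 * q / r)) := by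
      intro e
      rw [← Finset.mul_sum]
      by_cases he : G.Adj e.1 e.2
      · rw [SRGCounting.sum_gram_add_gram hG he fun z => Zg (z / r)]
      · simp [he]
    rw [Finset.sum_comm]
    simp only [h]
    rw [← Finset.sum_mul, Fintype.sum_prod_type, SRGRepresentation.sum_sum_adjMatrix hG, SRG.PsiB,
      ← hng]
    simp only [← hpdef, ← hqdef, ← hr, ← hZg]
    linear_combination (2 * v * Zg ((p + q) / r) - v * Zg (2 * q / r)) * hpar
  have hC : ∑ e : V × V, ∑ f : V × V, G.adjMatrix ℝ e.1 e.2 * (G.adjMatrix ℝ f.1 f.2 *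
      Zg ((M e.1 f.1 + M e.1 f.2 + M e.2 f.1 + M e.2 f.2) / (2 + 2 * p)))
      = 4 * (SRG.PsiC0 v k lam mu t
        + ((G.cliqueFinset 4).card : ℝ) * SRG.PsiC1 v k lam mu t) := by
    set f : ℝ → ℝ := fun z => Zg (z / (2 + 2 * p)) with hf
    have h : ∀ e : V × V, ∑ e' : V × V, G.adjMatrix ℝ e.1 e.2 * (G.adjMatrix ℝ e'.1 e'.2 *
        f (M e.1 e'.1 + M e.1 e'.2 + M e.2 e'.1 + M e.2 e'.2))
        = G.adjMatrix ℝ e.1 e.2 * (2 * f (2 + 2 * p) + 4 * lam * f (1 + 3 * p)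
            + 4 * (k - lam - 1) * f (1 + 2 * p + q) + f (4 * q) * (v * k - 4 * k + 2)
            + (f (p + 3 * q) - f (4 * q)) * (4 * ((k - 1) ^ 2 - lam))
            + (f (2 * p + 2 * q) - 2 * f (p + 3 * q) + f (4 * q)) * (4 * (lam * (k - 2))
              + 2 * (lam * (lam - 1) + (k - 1 - lam) * (mu - 1)))
            + (f (3 * p + q) - 3 * f (2 * p + 2 * q) + 3 * f (p + 3 * q) - f (4 * q))
              * (4 * (lam * (lam - 1))))
          + (f (4 * p) - 4 * f (3 * p + q) + 6 * f (2 * p + 2 * q) - 4 * f (p + 3 * q) + f (4 * q))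
            * (G.adjMatrix ℝ e.1 e.2 * ∑ c, ∑ d, G.adjMatrix ℝ c d *
              (G.adjMatrix ℝ e.1 c * G.adjMatrix ℝ e.1 d * G.adjMatrix ℝ e.2 c *
                G.adjMatrix ℝ e.2 d)) := by
      intro e
      rw [← Finset.mul_sum, Fintype.sum_prod_type]
      by_cases he : G.Adj e.1 e.2
      · rw [SRGCounting.sum_gram_edge hG he f]
        simp only [← hpdef, ← hqdef]
        ring
      · simp [he]
    refine (Finset.sum_congr rfl fun e _ => h e).trans ?_
    rw [Finset.sum_add_distrib, ← Finset.sum_mul, ← Finset.mul_sum, Fintype.sum_prod_type,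
      Fintype.sum_prod_type, SRGRepresentation.sum_sum_adjMatrix hG, SRGCounting.sum_four_clique]
    have h1 : f (2 + 2 * p) = Zg 1 := by
      simp only [hf, div_self hp2.ne']
    rw [h1, SRG.PsiC0, SRG.PsiC1, ← hng]
    have a0 : (4 - ((0 : ℕ) : ℝ)) * p + ((0 : ℕ) : ℝ) * q = 4 * p := by push_cast; ring
    have a1 : (4 - ((1 : ℕ) : ℝ)) * p + ((1 : ℕ) : ℝ) * q = 3 * p + q := by push_cast; ring
    have a2 : (4 - ((2 : ℕ) : ℝ)) * p + ((2 : ℕ) : ℝ) * q = 2 * p + 2 * q := by push_cast; ring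
    have a3 : (4 - ((3 : ℕ) : ℝ)) * p + ((3 : ℕ) : ℝ) * q = p + 3 * q := by push_cast; ring
    have a4 : (4 - ((4 : ℕ) : ℝ)) * p + ((4 : ℕ) : ℝ) * q = 4 * q := by push_cast; ring
    have c2 : Nat.choose 4 2 = 6 := rfl
    simp only [← hpdef, ← hqdef, ← hZg, hf, Finset.sum_range_succ, Finset.sum_range_zero, a0, a1,
      a2, a3, a4, Nat.choose_zero_right, Nat.choose_one_right, Nat.choose_self, c2,
      Nat.choose_succ_self_right]
    push_cast
    ring
  -- Weight `z` on the vertices, `1` on the ordered edges and `0` on the pairs that are not edges.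
  have hquad : ∀ z : ℝ, 0 ≤ SRG.PsiA v k lam mu t * (z * z) + 4 * SRG.PsiB v k lam mu t * z
      + 4 * (SRG.PsiC0 v k lam mu t
        + ((G.cliqueFinset 4).card : ℝ) * SRG.PsiC1 v k lam mu t) := by
    intro z
    have h := ZonalHarmonic.sum_mul_Z_nonneg hn ht
      (Sum.elim (fun _ : V => z) fun e : V × V => G.adjMatrix ℝ e.1 e.2) (Sum.elim x y) (by
        rintro (u | e) he
        · simp [hx, hM, SRGRepresentation.gram_self]
        · have hadj : G.Adj e.1 e.2 := by
            by_contra h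
            simp [h] at he
          simp only [Sum.elim_inr, hyy]
          rw [div_eq_one_iff_eq hp2.ne', hM, SRGRepresentation.gram_self,
            SRGRepresentation.gram_self, SRGRepresentation.gram_of_adj hadj,
            SRGRepresentation.gram_of_adj hadj.symm]
          ring)
    simp only [Fintype.sum_sum_type, Sum.elim_inl, Sum.elim_inr, hx, hxy, hyx, hyy,
      Finset.sum_add_distrib] at h
    have e1 : ∑ u, ∑ w, z * z * Zg (M u w) = z * z * SRG.PsiA v k lam mu t := by
      rw [← hA]
      simp only [Finset.mul_sum]
    have e2 : ∑ u, ∑ e : V × V, z * G.adjMatrix ℝ e.1 e.2 * Zg ((M u e.1 + M u e.2) / r)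
        = z * (2 * SRG.PsiB v k lam mu t) := by
      rw [← hB]
      simp only [Finset.mul_sum, mul_assoc]
    have e3 : ∑ e : V × V, ∑ u, G.adjMatrix ℝ e.1 e.2 * z * Zg ((M u e.1 + M u e.2) / r)
        = z * (2 * SRG.PsiB v k lam mu t) := by
      rw [← e2, Finset.sum_comm]
      simp only [mul_comm z]
    simp only [mul_assoc] at hC h e1 e2 e3
    rw [e1, e2, e3, hC] at h
    linarith
  have hdisc := discrim_le_zero hquad
  unfold discrim at hdisc
  linarith
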